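/- **Setting.** Let $d,m\ge 0$ and $n\ge 1$ be integers, let $f(x;\theta)$, $x\in\mathbb R^d$, $\theta\in\mathbb R^m$, be a real-valued model, and let $(x_i,y_i)$, $i=1,\dots,n$, be training data with $x_i\in\mathbb R^d$ and $y_i\in\{-1,1\}$. Let $\Lambda=\mathrm{diag}(\lambda_1,\dots,\lambda_m)$ be a non-zero diagonal matrix with $\lambda_j\ge 0$, and put $\lambda_{\max}=\max_j\lambda_j$, $\psi_\alpha(\theta)=e^{\alpha\Lambda}\theta$, $\|\theta\|_\Lambda^2=\sum_j\lambda_j\theta_j^2$ and $\|\theta\|_{\Lambda_{\max}}^2=\sum_{j:\lambda_j=\lambda_{\max}}\lambda_j\theta_j^2$. For $\theta$ with $\|\theta\|_\Lambda>0$ let $\hat\theta=\psi_{-\tau}(\theta)$, where $\tau=\tau(\theta)$ is the unique real number with $\|\psi_{-\tau}(\theta)\|_\Lambda=1$. For a locally Lipschitz $g:\mathbb R^m\to\mathbb R$, Clarke's subdifferential $\partial^\circ g(\theta)$ is the convex hull of all limits $\lim_k\nabla g(\theta_k)$ along sequences $\theta_k\to\theta$ of points at which $g$ is differentiable. An arc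 is a map $z:[0,\infty)\to\mathbb R^m$ that is absolutely continuous on compact intervals; $g$ admits a chain rule if for every arc $z$ and almost every $t>0$, $(g\circ z)'(t)=\langle h,z'(t)\rangle$ for all $h\in\partial^\circ g(z(t))$. **Theorem (Quasi-Homogeneous Maximum-Margin).** Assume: 1. (Quasi-homogeneity) $f(x;\psi_\alpha(\theta))=e^{\alpha}f(x;\theta)$ for all $\alpha\in\mathbb R$, $x\in\mathbb R^d$, $\theta\in\mathbb R^m$. 2. (Regularity) For every fixed $x$, $\theta\mapsto f(x;\theta)$ is locally Lipschitz and admits a chain rule. 3. (Exponential loss) $\mathcal L(\theta)=\frac1n\sum_{i=1}^n e^{-y_if(x_i;\theta)}$. 4. (Gradient flow) $\theta(t)$, $t\ge0$, is an arc with $\frac{d\theta}{dt}(t)\in-\partial^\circ\mathcal L(\theta(t))$ for almost every $t>0$. 5. (Strong separability) There is a time $t_0\ge0$ with $\mathcal L(\theta(t_0))<n^{-1}$. 6. (Normalized convergence) $\hat\theta_\infty:=\lim_{t\to\infty}\hat\theta(t)$ exists, where $\hat\theta(t)$ denotes the normalization of $\theta(t)$ (it is defined for all $t \ge t_0$). 7.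 (Conditional separability) There is $\kappa>0$ such that every $\theta$ with $y_if(x_i;\theta)>0$ for all $i$ satisfies $\|\hat\theta\|_{\Lambda_{\max}}\ge\kappa$. Then there is $\alpha\in\mathbb R$ such that $\theta^*=\psi_\alpha(\hat\theta_\infty)$ is a first-order KKT point of the problem $$\text{minimize}\quad \tfrac12\|\theta\|_{\Lambda_{\max}}^2\quad\text{subject to}\quad y_if(x_i;\theta)\ge1\ \text{ for all } i=1,\dots,n,$$ that is, $y_if(x_i;\theta^*)\ge 1$ for all $i$, and there exist $\mu_i\ge0$ and $h_i\in\partial^\circ_\theta f(x_i;\theta^*)$, $i=1,\dots,n$, such that $\nabla\big(\tfrac12\|\cdot\|_{\Lambda_{\max}}^2\big)(\theta^*)=\sum_i\mu_iy_ih_i$ and $\mu_i\,(y_if(x_i;\theta^*)-1)=0$ for all $i$. -/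

import Mathlib

open Set Filter Topology MeasureTheory
open scoped Gradient

noncomputable section

/-- The parameter transformation `ψ_α(θ) = e^{αΛ} θ`, where `Λ = diag(lam)`. -/
def psi {m : ℕ} (lam : Fin m → ℝ) (α : ℝ) (θ : EuclideanSpace ℝ (Fin m)) :
    EuclideanSpace ℝ (Fin m) :=
  WithLp.toLp 2 fun i => Real.exp (α * lam i) * θ i

/-- `g` is `Λ`-quasi-homogeneous: `g(ψ_α(θ)) = e^α g(θ)` for all real `α` and all `θ`. -/
def IsQuasiHomogeneous {m : ℕ} (lam : Fin m → ℝ) (g : EuclideanSpace ℝ (Fin m) → ℝ) : Prop :=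
  ∀ (α : ℝ) (θ : EuclideanSpace ℝ (Fin m)), g (psi lam α θ) = Real.exp α * g θ

/-- The squared `Λ`-seminorm `∑ i, λ_i θ_i²`. -/
def lamSeminormSq {m : ℕ} (lam : Fin m → ℝ) (θ : EuclideanSpace ℝ (Fin m)) : ℝ :=
  ∑ i, lam i * θ i ^ 2

/-- The largest rate `λ_max`. -/
def lamMax {m : ℕ} (lam : Fin m → ℝ) : ℝ := ⨆ i, lam i

open Classical in
/-- The squared `Λ_max`-seminorm: the sum of `λ_i θ_i²` over the `i` with `λ_i = λ_max`. -/
def lamMaxSeminormSq {m : ℕ} (lam : Fin m → ℝ) (θ : EuclideanSpace ℝ (Fin m)) : ℝ :=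
  ∑ i with lam i = lamMax lam, lam i * θ i ^ 2

open Classical in
/-- The number `τ(θ)` with `‖ψ_{-τ}(θ)‖_Λ² = 1`. It exists and is unique whenever `‖θ‖_Λ > 0`
(`existsUnique_lamTau`); the value is irrelevant otherwise. -/
def lamTau {m : ℕ} (lam : Fin m → ℝ) (θ : EuclideanSpace ℝ (Fin m)) : ℝ :=
  if h : ∃ τ : ℝ, lamSeminormSq lam (psi lam (-τ) θ) = 1 then h.choose else 0

/-- The `Λ`-normalized parameters `θ̂ = ψ_{-τ(θ)}(θ)`. -/
def lamNormalize {m : ℕ} (lam : Fin m → ℝ) (θ : EuclideanSpace ℝ (Fin m)) :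
    EuclideanSpace ℝ (Fin m) :=
  psi lam (-(lamTau lam θ)) θ

theorem existsUnique_lamTau {m : ℕ} (lam : Fin m → ℝ) (hlam : ∀ i, 0 ≤ lam i)
    (θ : EuclideanSpace ℝ (Fin m)) (hθ : 0 < lamSeminormSq lam θ) :
    ∃! τ : ℝ, lamSeminormSq lam (psi lam (-τ) θ) = 1 := by
  have hnn : ∀ i, 0 ≤ lam i * θ i ^ 2 := fun i => mul_nonneg (hlam i) (sq_nonneg _)
  obtain ⟨j, -, hj⟩ : ∃ j ∈ Finset.univ, 0 < lam j * θ j ^ 2 := by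
    by_contra! h
    exact absurd hθ (not_lt.2 (Finset.sum_nonpos h))
  have hlj : 0 < lam j := by
    rcases (hlam j).lt_or_eq with h | h
    · exact h
    · rw [← h] at hj
      simp at hj
  have hF : ∀ τ : ℝ, lamSeminormSq lam (psi lam (-τ) θ)
      = ∑ i, lam i * θ i ^ 2 * Real.exp (-(2 * τ * lam i)) := by
    intro τ
    refine Finset.sum_congr rfl fun i _ => ?_
    have : Real.exp (-(2 * τ * lam i)) = Real.exp (-τ * lam i) ^ 2 := by
      rw [← Real.exp_nat_mul]
      congr 1
      push_cast
      ring
    rw [this]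
    simp only [psi]
    ring
  have hanti : StrictAnti fun τ : ℝ => lamSeminormSq lam (psi lam (-τ) θ) := by
    intro a b hab
    simp only [hF]
    refine Finset.sum_lt_sum (fun i _ => ?_) ⟨j, Finset.mem_univ j, ?_⟩
    · refine mul_le_mul_of_nonneg_left (Real.exp_le_exp.2 ?_) (hnn i)
      nlinarith [hlam i]
    · refine mul_lt_mul_of_pos_left (Real.exp_lt_exp.2 ?_) hj
      nlinarith
  have hcont : Continuous fun τ : ℝ => lamSeminormSq lam (psi lam (-τ) θ) := by
    simp only [hF]
    fun_prop
  -- a time where the value is at least one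
  obtain ⟨a, ha⟩ : ∃ a : ℝ, 1 ≤ lamSeminormSq lam (psi lam (-a) θ) := by
    refine ⟨Real.log (lam j * θ j ^ 2) / (2 * lam j), ?_⟩
    rw [hF]
    refine le_trans (le_of_eq ?_) (Finset.single_le_sum
      (f := fun i => lam i * θ i ^ 2 *
        Real.exp (-(2 * (Real.log (lam j * θ j ^ 2) / (2 * lam j)) * lam i)))
      (fun i _ => mul_nonneg (hnn i) (Real.exp_pos _).le) (Finset.mem_univ j))
    have : 2 * (Real.log (lam j * θ j ^ 2) / (2 * lam j)) * lam j
        = Real.log (lam j * θ j ^ 2) := by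
      field_simp
    simp only [this, Real.exp_neg, Real.exp_log hj]
    rw [mul_inv_cancel₀ hj.ne']
  -- a time where the value is at most one
  obtain ⟨b, hb⟩ : ∃ b : ℝ, lamSeminormSq lam (psi lam (-b) θ) ≤ 1 := by
    have hlim : Tendsto (fun τ : ℝ => lamSeminormSq lam (psi lam (-τ) θ)) atTop (𝓝 0) := by
      have : (0 : ℝ) = ∑ _i : Fin m, (0 : ℝ) := by simp
      simp only [hF]
      rw [this]
      refine tendsto_finsetSum _ fun i _ => ?_
      rcases (hlam i).lt_or_eq with h | h
      · have h1 : Tendsto (fun τ : ℝ => 2 * τ * lam i) atTop atTop :=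
          (tendsto_id.const_mul_atTop (by norm_num : (0 : ℝ) < 2)).atTop_mul_const h
        simpa using (Real.tendsto_exp_neg_atTop_nhds_zero.comp h1).const_mul (lam i * θ i ^ 2)
      · simp [← h]
    obtain ⟨b, hb⟩ := (hlim.eventually (gt_mem_nhds one_pos)).exists
    exact ⟨b, hb.le⟩
  obtain ⟨τ, hτ⟩ := mem_range_of_exists_le_of_exists_ge hcont ⟨b, hb⟩ ⟨a, ha⟩
  exact ⟨τ, hτ, fun σ hσ => hanti.injective (hσ.trans hτ.symm)⟩

/-- Clarke's subdifferential of `g` at `θ`: the convex hull of all limits of gradients of `g` along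
sequences of points of differentiability of `g` converging to `θ`. -/
def clarkeSubdiff {m : ℕ} (g : EuclideanSpace ℝ (Fin m) → ℝ) (θ : EuclideanSpace ℝ (Fin m)) :
    Set (EuclideanSpace ℝ (Fin m)) :=
  convexHull ℝ {v | ∃ u : ℕ → EuclideanSpace ℝ (Fin m), Tendsto u atTop (𝓝 θ) ∧
    (∀ k, DifferentiableAt ℝ g (u k)) ∧ Tendsto (fun k => ∇ g (u k)) atTop (𝓝 v)}

/-- An arc `z : [0, ∞) → ℝ^m`: absolutely continuous on every compact interval `[0, T]`. -/
def IsArc {m : ℕ} (z : ℝ → EuclideanSpace ℝ (Fin m)) : Prop :=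
  ∀ T : ℝ, 0 < T → AbsolutelyContinuousOnInterval z 0 T

/-- `g` admits a chain rule: for every arc `z`, for almost every `t > 0`, one has
`(g ∘ z)'(t) = ⟨h, z'(t)⟩` for all `h` in the Clarke subdifferential of `g` at `z t`. -/
def AdmitsChainRule {m : ℕ} (g : EuclideanSpace ℝ (Fin m) → ℝ) : Prop :=
  ∀ z : ℝ → EuclideanSpace ℝ (Fin m), IsArc z →
    ∀ᵐ t ∂(volume.restrict (Ioi (0 : ℝ))), ∀ h ∈ clarkeSubdiff g (z t),
      HasDerivAt (fun s => g (z s)) (inner ℝ h (deriv z t)) t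

/-- The exponential loss `L(θ) = (1/n) ∑ i, exp(-y_i f(x_i; θ))`. -/
def expLoss {d m n : ℕ} (f : EuclideanSpace ℝ (Fin d) → EuclideanSpace ℝ (Fin m) → ℝ)
    (x : Fin n → EuclideanSpace ℝ (Fin d)) (y : Fin n → ℝ) (θ : EuclideanSpace ℝ (Fin m)) : ℝ :=
  (1 / (n : ℝ)) * ∑ i, Real.exp (-(y i * f (x i) θ))

/-- Gradient flow on `L`: an arc with `dθ/dt ∈ -∂°L(θ(t))` for almost every `t > 0`. -/
def IsGradientFlow {m : ℕ} (L : EuclideanSpace ℝ (Fin m) → ℝ)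
    (θ : ℝ → EuclideanSpace ℝ (Fin m)) : Prop :=
  IsArc θ ∧ ∀ᵐ t ∂(volume.restrict (Ioi (0 : ℝ))), -(deriv θ t) ∈ clarkeSubdiff L (θ t)

/-- `θ` separates the training data. -/
def Separates {d m n : ℕ} (f : EuclideanSpace ℝ (Fin d) → EuclideanSpace ℝ (Fin m) → ℝ)
    (x : Fin n → EuclideanSpace ℝ (Fin d)) (y : Fin n → ℝ) (θ : EuclideanSpace ℝ (Fin m)) : Prop :=
  ∀ i, 0 < y i * f (x i) θ

/-- Conditional separability: for some `κ > 0`, only `θ` with `‖θ̂‖_{Λ_max} ≥ κ` can separate the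
training data. -/
def ConditionallySeparable {d m n : ℕ} (lam : Fin m → ℝ)
    (f : EuclideanSpace ℝ (Fin d) → EuclideanSpace ℝ (Fin m) → ℝ)
    (x : Fin n → EuclideanSpace ℝ (Fin d)) (y : Fin n → ℝ) : Prop :=
  ∃ κ : ℝ, 0 < κ ∧ ∀ θ : EuclideanSpace ℝ (Fin m), Separates f x y θ →
    κ ≤ Real.sqrt (lamMaxSeminormSq lam (lamNormalize lam θ))

/-- `θ` is a first-order KKT point of: minimize `½ ‖θ‖²_{Λ_max}` subject to `y_i f(x_i; θ) ≥ 1`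
for all `i`. -/
def IsFirstOrderKKT {d m n : ℕ} (lam : Fin m → ℝ)
    (f : EuclideanSpace ℝ (Fin d) → EuclideanSpace ℝ (Fin m) → ℝ)
    (x : Fin n → EuclideanSpace ℝ (Fin d)) (y : Fin n → ℝ) (θ : EuclideanSpace ℝ (Fin m)) : Prop :=
  (∀ i, 1 ≤ y i * f (x i) θ) ∧
  ∃ (μ : Fin n → ℝ) (h : Fin n → EuclideanSpace ℝ (Fin m)),
    (∀ i, 0 ≤ μ i) ∧
    (∀ i, h i ∈ clarkeSubdiff (f (x i)) θ) ∧
    ∇ (fun ϑ => (1 / 2 : ℝ) * lamMaxSeminormSq lam ϑ) θ = ∑ i, (μ i * y i) • h i ∧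
    ∀ i, μ i * (y i * f (x i) θ - 1) = 0

end

/-! Write S for `lamSeminormSq` of θ(t), τ for `lamTau`, θ̂ for the normalized parameters, p for the
top-rate part `topProj` of their limit, a for the squared top seminorm of that limit, and γ for the
least margin there.

By the chain rule, the velocity is a combination of subgradients of the outputs weighted by the loss
(`exists_eq_sum_lossCoeff_of_mem_clarkeSubdiff`). Euler's identity turns ⟨Λθ, θ'⟩ into `lossRate`,
and Cauchy–Schwarz then shows that the smoothed margin divided by S^{1/(2λ_max)} never decreases.
Conditional separability bounds S below by a multiple of e^{2λ_max τ}. So the margins at θ̂ stay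
above a positive constant, S and τ tend to infinity, and the softmin weights concentrate on the
constraints active at the limit.

Convergence of θ̂ says nothing directly about θ'. Stationarity comes from a converse of L'Hôpital's
rule. Choose ρ with S = a e^{2λ_max ρ}; then ρ - τ → 0. For a vector v put Φ = ∑ v_j e^{(λ_j -
λ_max)ρ} θ_j and X = e^{λ_max ρ}, so that Φ/X → ⟨v, p⟩. If β < ⟨v, p⟩, then Φ' > βX' at arbitrarily
late times (`not_ae_hasDerivAt_nonpos_of_tendsto_div`). There Φ'/X' is explicit
(`exists_lt_sum_of_lt_inner`), and its subsequential limits have the form (a/γ)⟨v, q⟩ with q in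
`activeHull`. Were (γ/a)p outside this closed convex set, a separating v would give a contradiction
(`smul_topProj_mem_activeHull`). Equivariance of subgradients under ψ carries the membership to the
KKT conditions at the rescaled point. -/

noncomputable section

/-! ### Absolutely continuous curves -/

namespace AbsolutelyContinuousOnInterval

theorem comp_lipschitzOnWith {X Y : Type*} [PseudoMetricSpace X] [PseudoMetricSpace Y]
    {z : ℝ → X} {F : X → Y} {a b : ℝ} {K : NNReal} (hz : AbsolutelyContinuousOnInterval z a b)
    (hF : LipschitzOnWith K F (z '' uIcc a b)) :
    AbsolutelyContinuousOnInterval (fun t => F (z t)) a b := by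
  unfold AbsolutelyContinuousOnInterval at hz ⊢
  have hlim := hz.const_mul (K : ℝ)
  rw [mul_zero] at hlim
  refine squeeze_zero' (Eventually.of_forall fun _ => Finset.sum_nonneg fun _ _ => dist_nonneg) ?_
    hlim
  rw [eventually_inf_principal]
  refine Eventually.of_forall fun E hE => ?_
  rw [Finset.mul_sum]
  refine Finset.sum_le_sum fun i hi => ?_
  have h := hE.1 i hi
  exact hF.dist_le_mul (z (E.2 i).1) (mem_image_of_mem z h.1) (z (E.2 i).2)
    (mem_image_of_mem z h.2)

/-- The image of a compact interval is compact, so a locally Lipschitz map has a single Lipschitz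
constant on it. -/
theorem comp_locallyLipschitzOn {X Y : Type*} [NormedAddCommGroup X] [MetricSpace Y]
    {z : ℝ → X} {F : X → Y} {a b : ℝ} (hz : AbsolutelyContinuousOnInterval z a b)
    (hF : LocallyLipschitzOn (z '' uIcc a b) F) :
    AbsolutelyContinuousOnInterval (fun t => F (z t)) a b := by
  have hc : IsCompact (z '' uIcc a b) :=
    (isCompact_uIcc (a := a) (b := b)).image_of_continuousOn hz.continuousOn
  obtain ⟨K, hK⟩ := hF.exists_lipschitzOnWith_of_compact hc
  exact hz.comp_lipschitzOnWith hK

theorem comp_contDiffAt {E F : Type*} [NormedAddCommGroup E] [NormedSpace ℝ E]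
    [NormedAddCommGroup F] [NormedSpace ℝ F]
    {z : ℝ → E} {G : E → F} {a b : ℝ} (hz : AbsolutelyContinuousOnInterval z a b)
    (hG : ∀ t ∈ uIcc a b, ContDiffAt ℝ 1 G (z t)) :
    AbsolutelyContinuousOnInterval (fun t => G (z t)) a b := by
  refine hz.comp_locallyLipschitzOn ?_
  rintro _ ⟨t, ht, rfl⟩
  obtain ⟨K, s, hs, hK⟩ := (hG t ht).exists_lipschitzOnWith
  exact ⟨K, s, mem_nhdsWithin_of_mem_nhds hs, hK⟩

theorem finsetSum {ι F : Type*} [SeminormedAddCommGroup F] {z : ι → ℝ → F} {a b : ℝ}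
    (s : Finset ι) (hz : ∀ i ∈ s, AbsolutelyContinuousOnInterval (z i) a b) :
    AbsolutelyContinuousOnInterval (fun t => ∑ i ∈ s, z i t) a b := by
  classical
  induction s using Finset.induction_on with
  | empty =>
    simp only [Finset.sum_empty]
    exact (LipschitzWith.const (0 : F)).lipschitzOnWith.absolutelyContinuousOnInterval
  | insert i s hi ih =>
    simp only [Finset.sum_insert hi]
    exact (hz i (Finset.mem_insert_self i s)).fun_add
      (ih fun j hj => hz j (Finset.mem_insert_of_mem hj))

/-- Absolute continuity makes the increment equal to the integral of the derivative. Every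
monotonicity statement along the flow rests on this. -/
theorem le_of_ae_hasDerivAt_nonpos {f : ℝ → ℝ} {a b : ℝ} (hab : a ≤ b)
    (hf : AbsolutelyContinuousOnInterval f a b)
    (h : ∀ᵐ t, t ∈ Ioo a b → ∃ f' ≤ 0, HasDerivAt f f' t) : f b ≤ f a := by
  have h1 := hf.integral_deriv_eq_sub
  have h2 : ∫ t in a..b, deriv f t ≤ 0 := by
    rw [intervalIntegral.integral_of_le hab]
    refine integral_nonpos_of_ae ?_
    rw [EventuallyLE, ae_restrict_iff' measurableSet_Ioc]
    have hb : ∀ᵐ t : ℝ, t ≠ b := by simp [ae_iff]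
    filter_upwards [h, hb] with t ht htb hmem
    obtain ⟨f', hf', hd⟩ := ht ⟨hmem.1, lt_of_le_of_ne hmem.2 htb⟩
    simpa [hd.deriv] using hf'
  linarith

theorem ae_differentiableAt_vector {V : Type*} [NormedAddCommGroup V] [NormedSpace ℝ V]
    [FiniteDimensional ℝ V] {f : ℝ → V} {a b : ℝ} (hf : AbsolutelyContinuousOnInterval f a b) :
    ∀ᵐ t, t ∈ uIcc a b → DifferentiableAt ℝ f t :=
  hf.boundedVariationOn.ae_differentiableAt_of_mem_uIcc

end AbsolutelyContinuousOnInterval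

/-- Carathéodory's theorem with a fixed index type. -/
theorem exists_stdSimplex_of_mem_convexHull {E : Type*} [NormedAddCommGroup E] [NormedSpace ℝ E]
    [FiniteDimensional ℝ E] {s : Set E} {x : E} (hx : x ∈ convexHull ℝ s) :
    ∃ (w : Fin (Module.finrank ℝ E + 1) → ℝ) (v : Fin (Module.finrank ℝ E + 1) → E),
      w ∈ stdSimplex ℝ (Fin (Module.finrank ℝ E + 1)) ∧ (∀ l, v l ∈ s) ∧ ∑ l, w l • v l = x := by
  classical
  obtain ⟨ι, hι, z, w, hzs, hz, hw, hw1, rfl⟩ := eq_pos_convex_span_of_mem_convexHull hx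
  have hcard : Fintype.card ι ≤ Module.finrank ℝ E + 1 :=
    hz.card_le_finrank_succ.trans (Nat.succ_le_succ (Submodule.finrank_le _))
  obtain ⟨e⟩ : Nonempty (ι ↪ Fin (Module.finrank ℝ E + 1)) := by
    rw [Function.Embedding.nonempty_iff_card_le]
    simpa using hcard
  have hne : Nonempty ι := by
    by_contra h
    rw [not_nonempty_iff] at h
    simp at hw1
  have hw' : ∀ i, Function.extend e w 0 (e i) = w i := e.injective.extend_apply _ _
  have hz' : ∀ i, z (Function.invFun e (e i)) = z i := fun i => by
    rw [Function.leftInverse_invFun e.injective i]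
  have h0 : ∀ l, l ∉ range e → Function.extend e w 0 l = 0 := fun l hl =>
    Function.extend_apply' _ _ _ hl
  -- Slots outside the range of `e` get weight zero; the junk value of `invFun` there still selects
  -- a point of `s`.
  refine ⟨Function.extend e w 0, fun l => z (Function.invFun e l), ⟨fun l => ?_, ?_⟩,
    fun l => hzs (mem_range_self _), ?_⟩
  · by_cases hl : l ∈ range e
    · obtain ⟨i, rfl⟩ := hl
      rw [hw']
      exact (hw i).le
    · rw [h0 l hl]
  · rw [← hw1]
    exact (Fintype.sum_of_injective e e.injective _ _ h0 fun i => (hw' i).symm).symm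
  · refine (Fintype.sum_of_injective e e.injective _ _ (fun l hl => ?_) fun i => ?_).symm
    · rw [h0 l hl, zero_smul]
    · simp only [hw', hz']

/-! ### Compactness and closedness of the Clarke subdifferential -/

section Clarke

variable {m : ℕ}

/-- The limits of gradients of `g` along sequences converging to `θ`. -/
def limitingGradients (g : EuclideanSpace ℝ (Fin m) → ℝ) (θ : EuclideanSpace ℝ (Fin m)) :
    Set (EuclideanSpace ℝ (Fin m)) :=
  {v | ∃ u : ℕ → EuclideanSpace ℝ (Fin m), Tendsto u atTop (𝓝 θ) ∧
    (∀ k, DifferentiableAt ℝ g (u k)) ∧ Tendsto (fun k => ∇ g (u k)) atTop (𝓝 v)}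

theorem convex_clarkeSubdiff (g : EuclideanSpace ℝ (Fin m) → ℝ) (θ : EuclideanSpace ℝ (Fin m)) :
    Convex ℝ (clarkeSubdiff g θ) := convex_convexHull ℝ _

/-- Seen as a closure of the graph of the gradient, the limiting gradients visibly have closed
graph, with no diagonal argument. -/
theorem mem_limitingGradients_iff {g : EuclideanSpace ℝ (Fin m) → ℝ}
    {θ v : EuclideanSpace ℝ (Fin m)} :
    v ∈ limitingGradients g θ ↔
      (θ, v) ∈ closure ((fun u => (u, ∇ g u)) '' {u | DifferentiableAt ℝ g u}) := by
  rw [mem_closure_iff_seq_limit]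
  constructor
  · rintro ⟨u, hu, hd, hv⟩
    exact ⟨fun k => (u k, ∇ g (u k)), fun k => mem_image_of_mem _ (hd k), hu.prodMk_nhds hv⟩
  · rintro ⟨p, hp, hlim⟩
    choose u hu hpu using hp
    have h1 : Tendsto (fun k => (u k, ∇ g (u k))) atTop (𝓝 (θ, v)) := by
      simpa only [hpu] using hlim
    exact ⟨u, (continuous_fst.tendsto _).comp h1, hu, (continuous_snd.tendsto _).comp h1⟩

theorem mem_limitingGradients_of_tendsto {g : EuclideanSpace ℝ (Fin m) → ℝ}
    {θ v : EuclideanSpace ℝ (Fin m)} {θs vs : ℕ → EuclideanSpace ℝ (Fin m)}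
    (hmem : ∀ k, vs k ∈ limitingGradients g (θs k)) (hθ : Tendsto θs atTop (𝓝 θ))
    (hv : Tendsto vs atTop (𝓝 v)) : v ∈ limitingGradients g θ := by
  rw [mem_limitingGradients_iff]
  exact isClosed_closure.mem_of_tendsto (hθ.prodMk_nhds hv)
    (Eventually.of_forall fun k => mem_limitingGradients_iff.1 (hmem k))

/-- A local Lipschitz constant bounds nearby gradients, and the bound survives limits and convex
combinations. -/
theorem LocallyLipschitz.eventually_norm_clarkeSubdiff_le {g : EuclideanSpace ℝ (Fin m) → ℝ}
    (hg : LocallyLipschitz g) (θ : EuclideanSpace ℝ (Fin m)) :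
    ∃ K : ℝ, ∀ᶠ z in 𝓝 θ, ∀ h ∈ clarkeSubdiff g z, ‖h‖ ≤ K := by
  obtain ⟨K, s, hs, hK⟩ := hg θ
  refine ⟨K, ?_⟩
  filter_upwards [eventually_mem_nhds_iff.2 hs] with z hz h hh
  have hsub : limitingGradients g z ⊆ Metric.closedBall 0 K := by
    rintro v ⟨u, hu, hd, hv⟩
    refine Metric.isClosed_closedBall.mem_of_tendsto hv ?_
    filter_upwards [hu.eventually (eventually_mem_nhds_iff.2 hz)] with k hk
    rw [mem_closedBall_zero_iff, ← (InnerProductSpace.toDual ℝ _).norm_map, toDual_gradient]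
    exact norm_fderiv_le_of_lipschitzOn ℝ hk hK
  simpa using convexHull_min hsub (convex_closedBall _ _) hh

/-- By Rademacher's theorem the non-differentiability set is locally null, whereas nonempty open
sets have positive measure. -/
theorem LocallyLipschitz.dense_differentiableAt {g : EuclideanSpace ℝ (Fin m) → ℝ}
    (hg : LocallyLipschitz g) : Dense {u | DifferentiableAt ℝ g u} := by
  intro θ
  obtain ⟨K, s, hs, hK⟩ := hg θ
  rw [mem_closure_iff_nhds]
  intro t ht
  obtain ⟨o, ho, hoo, hθo⟩ := mem_nhds_iff.1 (inter_mem hs ht)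
  have hae := (hK.mono (ho.trans inter_subset_left)).ae_differentiableWithinAt_of_mem
    (μ := volume)
  by_contra hne
  have hnull : volume o = 0 := by
    refine measure_mono_null ?_ (ae_iff.1 hae)
    intro u hu hd
    exact hne ⟨u, (ho hu).2, (hd hu).differentiableAt (hoo.mem_nhds hu)⟩
  exact (hoo.measure_pos volume ⟨θ, hθo⟩).ne' hnull

theorem LocallyLipschitz.limitingGradients_nonempty {g : EuclideanSpace ℝ (Fin m) → ℝ}
    (hg : LocallyLipschitz g) (θ : EuclideanSpace ℝ (Fin m)) :
    (limitingGradients g θ).Nonempty := by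
  obtain ⟨u, hu, hlim⟩ := mem_closure_iff_seq_limit.1 (hg.dense_differentiableAt θ)
  obtain ⟨K, s, hs, hK⟩ := hg θ
  have hb : ∀ᶠ k in atTop, ∇ g (u k) ∈ Metric.closedBall (0 : EuclideanSpace ℝ (Fin m)) K := by
    filter_upwards [hlim.eventually (eventually_mem_nhds_iff.2 hs)] with k hk
    rw [mem_closedBall_zero_iff, ← (InnerProductSpace.toDual ℝ _).norm_map, toDual_gradient]
    exact norm_fderiv_le_of_lipschitzOn ℝ hk hK
  obtain ⟨v, -, φ, hφ, hv⟩ := tendsto_subseq_of_frequently_bounded Metric.isBounded_closedBall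
    hb.frequently
  exact ⟨v, fun k => u (φ k), hlim.comp hφ.tendsto_atTop, fun k => hu _, hv⟩

theorem LocallyLipschitz.clarkeSubdiff_nonempty {g : EuclideanSpace ℝ (Fin m) → ℝ}
    (hg : LocallyLipschitz g) (θ : EuclideanSpace ℝ (Fin m)) :
    (clarkeSubdiff g θ).Nonempty :=
  (hg.limitingGradients_nonempty θ).convexHull

/-- Carathéodory fixes the number of terms in the convex combinations, so weights and limiting
gradients subconverge separately. -/
theorem LocallyLipschitz.mem_clarkeSubdiff_of_tendsto {g : EuclideanSpace ℝ (Fin m) → ℝ}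
    (hg : LocallyLipschitz g) {θ h : EuclideanSpace ℝ (Fin m)}
    {θs hs : ℕ → EuclideanSpace ℝ (Fin m)} (hmem : ∀ k, hs k ∈ clarkeSubdiff g (θs k))
    (hθ : Tendsto θs atTop (𝓝 θ)) (hh : Tendsto hs atTop (𝓝 h)) : h ∈ clarkeSubdiff g θ := by
  choose w v hw hv hsum using fun k => exists_stdSimplex_of_mem_convexHull (hmem k)
  obtain ⟨K, hK⟩ := hg.eventually_norm_clarkeSubdiff_le θ
  have hvb : ∀ᶠ k in atTop, v k ∈ Metric.closedBall
      (0 : Fin (Module.finrank ℝ (EuclideanSpace ℝ (Fin m)) + 1) → EuclideanSpace ℝ (Fin m)) K := by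
    filter_upwards [hθ.eventually hK] with k hk
    rw [mem_closedBall_zero_iff, pi_norm_le_iff_of_nonempty]
    exact fun l => hk _ (subset_convexHull ℝ _ (hv k l))
  obtain ⟨w₀, hw₀, φ, hφ, hwφ⟩ := (isCompact_stdSimplex ℝ _).tendsto_subseq hw
  obtain ⟨v₀, -, ψ, hψ, hvψ⟩ := tendsto_subseq_of_frequently_bounded
    Metric.isBounded_closedBall (hφ.tendsto_atTop.eventually hvb).frequently
  have hχ : Tendsto (fun k => φ (ψ k)) atTop atTop := hφ.tendsto_atTop.comp hψ.tendsto_atTop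
  have hw1 : ∀ l, Tendsto (fun k => w (φ (ψ k)) l) atTop (𝓝 (w₀ l)) :=
    tendsto_pi_nhds.1 (hwφ.comp hψ.tendsto_atTop)
  have hv1 : ∀ l, Tendsto (fun k => v (φ (ψ k)) l) atTop (𝓝 (v₀ l)) := tendsto_pi_nhds.1 hvψ
  have hlim : Tendsto (fun k => hs (φ (ψ k))) atTop (𝓝 (∑ l, w₀ l • v₀ l)) := by
    simp only [← hsum]
    exact tendsto_finsetSum _ fun l _ => (hw1 l).smul (hv1 l)
  rw [tendsto_nhds_unique (hh.comp hχ) hlim]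
  refine (convex_clarkeSubdiff g θ).sum_mem (fun l _ => hw₀.1 l) hw₀.2 fun l _ => ?_
  exact subset_convexHull ℝ _ (mem_limitingGradients_of_tendsto
    (fun k => hv (φ (ψ k)) l) (hθ.comp hχ) (hv1 l))

theorem exists_subseq_tendsto_clarkeSubdiff {ι : Type*} [Fintype ι]
    {g : ι → EuclideanSpace ℝ (Fin m) → ℝ} (hg : ∀ i, LocallyLipschitz (g i))
    {θ : EuclideanSpace ℝ (Fin m)} {θs : ℕ → EuclideanSpace ℝ (Fin m)}
    {hs : ℕ → ι → EuclideanSpace ℝ (Fin m)} (hmem : ∀ k i, hs k i ∈ clarkeSubdiff (g i) (θs k))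
    (hθ : Tendsto θs atTop (𝓝 θ)) :
    ∃ (h : ι → EuclideanSpace ℝ (Fin m)) (φ : ℕ → ℕ), StrictMono φ ∧
      (∀ i, h i ∈ clarkeSubdiff (g i) θ) ∧ Tendsto (fun k => hs (φ k)) atTop (𝓝 h) := by
  choose K hK using fun i => (hg i).eventually_norm_clarkeSubdiff_le θ
  have hb : ∀ᶠ k in atTop, hs k ∈ univ.pi fun i =>
      Metric.closedBall (0 : EuclideanSpace ℝ (Fin m)) (K i) := by
    filter_upwards [hθ.eventually (eventually_all.2 hK)] with k hk
    exact fun i _ => mem_closedBall_zero_iff.2 (hk i _ (hmem k i))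
  obtain ⟨h, -, φ, hφ, hlim⟩ := tendsto_subseq_of_frequently_bounded
    (Bornology.IsBounded.pi fun i => Metric.isBounded_closedBall) hb.frequently
  exact ⟨h, φ, hφ, fun i => (hg i).mem_clarkeSubdiff_of_tendsto (fun k => hmem (φ k) i)
    (hθ.comp hφ.tendsto_atTop) (tendsto_pi_nhds.1 hlim i), hlim⟩

theorem exists_inner_lt_of_notMem {s : Set (EuclideanSpace ℝ (Fin m))} (hs : Convex ℝ s)
    (hc : IsClosed s) {p : EuclideanSpace ℝ (Fin m)} (hp : p ∉ s) :
    ∃ (w : EuclideanSpace ℝ (Fin m)) (r : ℝ), (∀ k ∈ s, inner ℝ w k < r) ∧ r < inner ℝ w p := by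
  obtain ⟨F, r, hF, hr⟩ := geometric_hahn_banach_closed_point hs hc hp
  refine ⟨(InnerProductSpace.toDual ℝ _).symm F, r, fun k hk => ?_, ?_⟩
  · simpa using hF k hk
  · simpa using hr

theorem isClosed_image_pi_clarkeSubdiff {ι : Type*} [Fintype ι]
    {g : ι → EuclideanSpace ℝ (Fin m) → ℝ} (hg : ∀ i, LocallyLipschitz (g i))
    (θ : EuclideanSpace ℝ (Fin m)) (c : ι → ℝ) :
    IsClosed {v | ∃ h : ι → EuclideanSpace ℝ (Fin m),
      (∀ i, h i ∈ clarkeSubdiff (g i) θ) ∧ v = ∑ i, c i • h i} := by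
  refine IsSeqClosed.isClosed fun vs v hvs hv => ?_
  choose hs hmem hsum using hvs
  obtain ⟨h, φ, hφ, hh, hlim⟩ := exists_subseq_tendsto_clarkeSubdiff hg hmem
    (tendsto_const_nhds (x := θ))
  refine ⟨h, hh, tendsto_nhds_unique (hv.comp hφ.tendsto_atTop) ?_⟩
  have : vs ∘ φ = fun k => ∑ i, c i • hs (φ k) i := funext fun k => hsum (φ k)
  rw [this]
  exact tendsto_finsetSum _ fun i _ => (tendsto_pi_nhds.1 hlim i).const_smul (c i)

theorem convex_image_pi_clarkeSubdiff {ι : Type*} [Fintype ι]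
    (g : ι → EuclideanSpace ℝ (Fin m) → ℝ) (θ : EuclideanSpace ℝ (Fin m)) (c : ι → ℝ) :
    Convex ℝ {v | ∃ h : ι → EuclideanSpace ℝ (Fin m),
      (∀ i, h i ∈ clarkeSubdiff (g i) θ) ∧ v = ∑ i, c i • h i} := by
  rintro _ ⟨h, hh, rfl⟩ _ ⟨h', hh', rfl⟩ a b ha hb hab
  refine ⟨fun i => a • h i + b • h' i, fun i =>
    convex_clarkeSubdiff (g i) θ (hh i) (hh' i) ha hb hab, ?_⟩
  simp only [smul_add, Finset.smul_sum, ← Finset.sum_add_distrib]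
  refine Finset.sum_congr rfl fun i _ => ?_
  rw [smul_comm a, smul_comm b]

end Clarke

/-! ### Subgradients of the loss in terms of subgradients of the outputs -/

section LossSubdifferential

variable {d m n : ℕ} {f : EuclideanSpace ℝ (Fin d) → EuclideanSpace ℝ (Fin m) → ℝ}
  {x : Fin n → EuclideanSpace ℝ (Fin d)} {y : Fin n → ℝ}

/-- The partial derivative of the exponential loss with respect to the `i`-th model output. -/
def lossCoeff (f : EuclideanSpace ℝ (Fin d) → EuclideanSpace ℝ (Fin m) → ℝ)
    (x : Fin n → EuclideanSpace ℝ (Fin d)) (y : Fin n → ℝ) (u : EuclideanSpace ℝ (Fin m))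
    (i : Fin n) : ℝ :=
  -(1 / (n : ℝ) * Real.exp (-(y i * f (x i) u)) * y i)

theorem AbsolutelyContinuousOnInterval.expLoss_comp (hlip : ∀ a, LocallyLipschitz (f a))
    {z : ℝ → EuclideanSpace ℝ (Fin m)} {a b : ℝ} (hz : AbsolutelyContinuousOnInterval z a b) :
    AbsolutelyContinuousOnInterval (fun t => expLoss f x y (z t)) a b := by
  unfold expLoss
  refine (AbsolutelyContinuousOnInterval.finsetSum _ fun i _ => ?_).const_mul _
  have h1 : AbsolutelyContinuousOnInterval (fun t => f (x i) (z t)) a b :=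
    hz.comp_locallyLipschitzOn (hlip (x i)).locallyLipschitzOn
  exact h1.comp_contDiffAt (G := fun r => Real.exp (-(y i * r))) fun t _ => by fun_prop

theorem hasDerivAt_expLoss_comp {z : ℝ → EuclideanSpace ℝ (Fin m)} {t : ℝ}
    {w : EuclideanSpace ℝ (Fin m)} {h : Fin n → EuclideanSpace ℝ (Fin m)}
    (hd : ∀ i, HasDerivAt (fun s => f (x i) (z s)) (inner ℝ (h i) w) t) :
    HasDerivAt (fun s => expLoss f x y (z s))
      (inner ℝ (∑ i, lossCoeff f x y (z t) i • h i) w) t := by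
  have h1 : ∀ i ∈ Finset.univ, HasDerivAt (fun s => Real.exp (-(y i * f (x i) (z s))))
      (Real.exp (-(y i * f (x i) (z t))) * -(y i * inner ℝ (h i) w)) t := fun i _ =>
    (((hd i).const_mul (y i)).fun_neg).exp
  refine ((HasDerivAt.fun_sum h1).const_mul (1 / (n : ℝ))).congr_deriv ?_
  rw [sum_inner, Finset.mul_sum]
  refine Finset.sum_congr rfl fun i _ => ?_
  rw [real_inner_smul_left, lossCoeff]
  ring

theorem continuous_lossCoeff (hlip : ∀ a, LocallyLipschitz (f a)) (i : Fin n) :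
    Continuous fun u => lossCoeff f x y u i := by
  unfold lossCoeff
  have := (hlip (x i)).continuous
  fun_prop

theorem exists_subseq_tendsto_sum_lossCoeff (hlip : ∀ a, LocallyLipschitz (f a))
    {u : EuclideanSpace ℝ (Fin m)} {us : ℕ → EuclideanSpace ℝ (Fin m)}
    {hs : ℕ → Fin n → EuclideanSpace ℝ (Fin m)}
    (hmem : ∀ k i, hs k i ∈ clarkeSubdiff (f (x i)) (us k)) (hu : Tendsto us atTop (𝓝 u)) :
    ∃ (h : Fin n → EuclideanSpace ℝ (Fin m)) (φ : ℕ → ℕ), StrictMono φ ∧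
      (∀ i, h i ∈ clarkeSubdiff (f (x i)) u) ∧
      Tendsto (fun k => ∑ i, lossCoeff f x y (us (φ k)) i • hs (φ k) i) atTop
        (𝓝 (∑ i, lossCoeff f x y u i • h i)) := by
  obtain ⟨h, φ, hφ, hh, hlim⟩ := exists_subseq_tendsto_clarkeSubdiff (fun i => hlip (x i)) hmem hu
  refine ⟨h, φ, hφ, hh, tendsto_finsetSum _ fun i _ => ?_⟩
  exact (((continuous_lossCoeff hlip i).tendsto u).comp (hu.comp hφ.tendsto_atTop)).smul
    (tendsto_pi_nhds.1 hlim i)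

theorem isArc_line (u w : EuclideanSpace ℝ (Fin m)) : IsArc fun s : ℝ => u + s • w := by
  intro T _
  refine ContDiffOn.absolutelyContinuousOnInterval (ContDiff.contDiffOn ?_)
  fun_prop

/-- The combinations on the right form a closed convex set. A gradient outside it would be separated
from it by some direction w, and the chain rule along the line u + s w bounds the derivative in that
direction by the separating constant. -/
theorem gradient_expLoss_mem (hlip : ∀ a, LocallyLipschitz (f a))
    (hchain : ∀ a, AdmitsChainRule (f a)) {u : EuclideanSpace ℝ (Fin m)}
    (hu : DifferentiableAt ℝ (expLoss f x y) u) :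
    ∃ h : Fin n → EuclideanSpace ℝ (Fin m), (∀ i, h i ∈ clarkeSubdiff (f (x i)) u) ∧
      ∇ (expLoss f x y) u = ∑ i, lossCoeff f x y u i • h i := by
  by_contra hnot
  obtain ⟨w, r, hC, hr⟩ := exists_inner_lt_of_notMem
    (convex_image_pi_clarkeSubdiff (fun i => f (x i)) u (lossCoeff f x y u))
    (isClosed_image_pi_clarkeSubdiff (fun i => hlip (x i)) u (lossCoeff f x y u)) hnot
  -- The separating inequality persists near u: otherwise violating subgradients at points tending
  -- to u would subconverge to a violating element of the set at u.
  have hev : ∀ᶠ z in 𝓝 u, ∀ h : Fin n → EuclideanSpace ℝ (Fin m),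
      (∀ i, h i ∈ clarkeSubdiff (f (x i)) z) → inner ℝ w (∑ i, lossCoeff f x y z i • h i) < r := by
    by_contra hfreq
    obtain ⟨zs, hzs, hp⟩ := exists_seq_forall_of_frequently (not_eventually.1 hfreq)
    push Not at hp
    choose hs hmem hle using hp
    obtain ⟨h, φ, hφ, hh, hlim⟩ := exists_subseq_tendsto_sum_lossCoeff (y := y) hlip hmem hzs
    refine absurd (hC _ ⟨h, hh, rfl⟩) (not_lt.2 ?_)
    exact ge_of_tendsto (tendsto_const_nhds.inner hlim) (Eventually.of_forall fun k => hle (φ k))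
  have hz : ∀ s : ℝ, HasDerivAt (fun s : ℝ => u + s • w) w s := fun s => by
    simpa using ((hasDerivAt_id s).smul_const w).const_add u
  have hz0 : Tendsto (fun s : ℝ => u + s • w) (𝓝 0) (𝓝 u) := by
    simpa [ContinuousAt] using (hz 0).continuousAt
  obtain ⟨δ, hδ, hball⟩ := Metric.eventually_nhds_iff.1 (hz0.eventually hev)
  have hae := ae_all_iff.2 fun i => hchain (x i) _ (isArc_line u w)
  rw [ae_restrict_iff' measurableSet_Ioi] at hae
  -- The loss minus r s has nonpositive derivative almost everywhere on the segment, which bounds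
  -- the difference quotients at 0 by r.
  have hslope : ∀ T ∈ Ioo 0 δ, slope (fun s : ℝ => expLoss f x y (u + s • w)) 0 T ≤ r := by
    intro T hT
    have hac : AbsolutelyContinuousOnInterval
        (fun s : ℝ => expLoss f x y (u + s • w) - r * s) 0 T :=
      ((isArc_line u w T hT.1).expLoss_comp hlip).fun_sub
        (ContDiffOn.absolutelyContinuousOnInterval (ContDiff.contDiffOn (by fun_prop)))
    have hle := hac.le_of_ae_hasDerivAt_nonpos hT.1.le (by
      filter_upwards [hae] with s hs hsT
      choose h hh using fun i => (hlip (x i)).clarkeSubdiff_nonempty (u + s • w)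
      have hd := hasDerivAt_expLoss_comp (y := y) (fun i => hs hsT.1 i (h i) (hh i))
      rw [(hz s).deriv] at hd
      refine ⟨_, ?_, hd.fun_sub ((hasDerivAt_id' s).const_mul r)⟩
      have := hball (y := s) (by
        rw [Real.dist_eq, sub_zero, abs_of_pos hsT.1]
        exact hsT.2.trans hT.2) h hh
      rw [real_inner_comm]
      linarith)
    rw [slope_def_field, div_le_iff₀ (by linarith [hT.1])]
    simp only [zero_smul, add_zero, mul_zero, sub_zero] at hle ⊢
    linarith
  have hgrad : HasDerivAt (fun s : ℝ => expLoss f x y (u + s • w))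
      (inner ℝ w (∇ (expLoss f x y) u)) 0 := by
    have h1 : HasFDerivAt (expLoss f x y) (fderiv ℝ (expLoss f x y) u)
        ((fun s : ℝ => u + s • w) 0) := by
      simpa using hu.hasFDerivAt
    have h2 := h1.comp_hasDerivAt (0 : ℝ) (hz 0)
    rw [real_inner_comm, inner_gradient_left]
    exact h2
  have hlim := (hasDerivAt_iff_tendsto_slope.1 hgrad).mono_left
    (nhdsWithin_mono _ (show Ioi (0 : ℝ) ⊆ {0}ᶜ from fun s hs => ne_of_gt hs))
  have hle : inner ℝ w (∇ (expLoss f x y) u) ≤ r := by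
    refine le_of_tendsto hlim ?_
    filter_upwards [Ioo_mem_nhdsGT hδ] with T hT using hslope T hT
  linarith

/-- The subdifferential of the loss decomposes through the subdifferentials of the outputs. -/
theorem exists_eq_sum_lossCoeff_of_mem_clarkeSubdiff (hlip : ∀ a, LocallyLipschitz (f a))
    (hchain : ∀ a, AdmitsChainRule (f a)) {u v : EuclideanSpace ℝ (Fin m)}
    (hv : v ∈ clarkeSubdiff (expLoss f x y) u) :
    ∃ h : Fin n → EuclideanSpace ℝ (Fin m), (∀ i, h i ∈ clarkeSubdiff (f (x i)) u) ∧
      v = ∑ i, lossCoeff f x y u i • h i := by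
  refine convexHull_min ?_
    (convex_image_pi_clarkeSubdiff (fun i => f (x i)) u (lossCoeff f x y u)) hv
  rintro v ⟨us, hus, hd, hlim⟩
  choose hs hmem hsum using fun k => gradient_expLoss_mem hlip hchain (hd k)
  obtain ⟨h, φ, hφ, hh, hlim'⟩ := exists_subseq_tendsto_sum_lossCoeff (y := y) hlip hmem hus
  refine ⟨h, hh, tendsto_nhds_unique (hlim.comp hφ.tendsto_atTop) ?_⟩
  simpa only [Function.comp_def, hsum] using hlim'

end LossSubdifferential

/-! ### Euler's identity and equivariance under ψ -/

section QuasiHomogeneous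

variable {m : ℕ} {lam : Fin m → ℝ}

@[simp] theorem psi_apply (lam : Fin m → ℝ) (α : ℝ) (θ : EuclideanSpace ℝ (Fin m)) (j : Fin m) :
    psi lam α θ j = Real.exp (α * lam j) * θ j := rfl

/-- `psi lam α` as a continuous linear map. -/
def psiCLM (lam : Fin m → ℝ) (α : ℝ) :
    EuclideanSpace ℝ (Fin m) →L[ℝ] EuclideanSpace ℝ (Fin m) :=
  LinearMap.toContinuousLinearMap
    { toFun := psi lam α
      map_add' := fun u v => by ext j; simp [mul_add]
      map_smul' := fun c u => by ext j; simp [mul_left_comm] }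

@[simp] theorem psiCLM_apply (lam : Fin m → ℝ) (α : ℝ) (θ : EuclideanSpace ℝ (Fin m)) :
    psiCLM lam α θ = psi lam α θ := rfl

theorem psi_psi (lam : Fin m → ℝ) (α β : ℝ) (θ : EuclideanSpace ℝ (Fin m)) :
    psi lam α (psi lam β θ) = psi lam (α + β) θ := by
  ext j
  simp only [psi_apply, ← mul_assoc, ← Real.exp_add, ← add_mul]

@[simp] theorem psi_zero (lam : Fin m → ℝ) (θ : EuclideanSpace ℝ (Fin m)) : psi lam 0 θ = θ := by
  ext j
  simp

theorem inner_psi_left (lam : Fin m → ℝ) (α : ℝ) (u v : EuclideanSpace ℝ (Fin m)) :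
    inner ℝ (psi lam α u) v = inner ℝ u (psi lam α v) := by
  simp only [PiLp.inner_apply, psi_apply, RCLike.inner_apply, conj_trivial]
  exact Finset.sum_congr rfl fun j _ => by ring

/-- The vector field `Λ θ` generating the flow `ψ`. -/
def lamScale (lam : Fin m → ℝ) (θ : EuclideanSpace ℝ (Fin m)) : EuclideanSpace ℝ (Fin m) :=
  WithLp.toLp 2 fun j => lam j * θ j

@[simp] theorem lamScale_apply (lam : Fin m → ℝ) (θ : EuclideanSpace ℝ (Fin m)) (j : Fin m) :
    lamScale lam θ j = lam j * θ j := rfl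

theorem continuous_lamScale (lam : Fin m → ℝ) : Continuous (lamScale lam) := by
  unfold lamScale
  fun_prop

theorem hasDerivAt_psi (lam : Fin m → ℝ) (θ : EuclideanSpace ℝ (Fin m)) :
    HasDerivAt (fun α => psi lam α θ) (lamScale lam θ) 0 := by
  have h : HasDerivAt (fun α j => Real.exp (α * lam j) * θ j) (fun j => lam j * θ j) 0 :=
    hasDerivAt_pi.2 fun j => by
      simpa using (((hasDerivAt_id' (0 : ℝ)).mul_const (lam j)).exp).mul_const (θ j)
  exact ((PiLp.hasFDerivAt_toLp 2 _).comp_hasDerivAt (0 : ℝ) h :)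

variable {g : EuclideanSpace ℝ (Fin m) → ℝ}

/-- Euler's identity. -/
theorem IsQuasiHomogeneous.inner_lamScale (hq : IsQuasiHomogeneous lam g) (hg : Continuous g)
    {θ h : EuclideanSpace ℝ (Fin m)} (hh : h ∈ clarkeSubdiff g θ) :
    inner ℝ h (lamScale lam θ) = g θ := by
  -- At differentiability points, differentiate g(ψ_α u) = e^α g(u) at α = 0; the identity is affine
  -- in h and closed under limits.
  have hdiff : ∀ u, DifferentiableAt ℝ g u → inner ℝ (∇ g u) (lamScale lam u) = g u := by
    intro u hu
    have h1 : HasFDerivAt g (fderiv ℝ g u) ((fun α => psi lam α u) 0) := by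
      simpa using hu.hasFDerivAt
    have h2 := h1.comp_hasDerivAt (0 : ℝ) (hasDerivAt_psi lam u)
    have h3 : HasDerivAt (fun α => Real.exp α * g u) (Real.exp 0 * g u) 0 :=
      (Real.hasDerivAt_exp 0).mul_const (g u)
    have h4 : (g ∘ fun α => psi lam α u) = fun α => Real.exp α * g u :=
      funext fun α => hq α u
    rw [h4] at h2
    rw [inner_gradient_left, h2.unique h3]
    simp
  have hconv : Convex ℝ {h : EuclideanSpace ℝ (Fin m) | inner ℝ h (lamScale lam θ) = g θ} := by
    intro a ha b hb s t hs ht hst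
    simp only [mem_ofPred_eq] at ha hb ⊢
    rw [inner_add_left, real_inner_smul_left, real_inner_smul_left, ha, hb, ← add_mul, hst, one_mul]
  refine convexHull_min ?_ hconv hh
  rintro v ⟨u, hu, hd, hv⟩
  have h1 := hv.inner (𝕜 := ℝ) (((continuous_lamScale lam).tendsto θ).comp hu)
  have h2 := (hg.tendsto θ).comp hu
  refine tendsto_nhds_unique h1 ?_
  simpa only [Function.comp_def, hdiff _ (hd _)] using h2

/-- Differentiate g = e^α g ∘ ψ_{-α}; the diagonal map ψ_{-α} is its own adjoint. -/
theorem IsQuasiHomogeneous.hasGradientAt_psi (hq : IsQuasiHomogeneous lam g) (α : ℝ)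
    {u : EuclideanSpace ℝ (Fin m)} (hu : DifferentiableAt ℝ g u) :
    HasGradientAt g (Real.exp α • psi lam (-α) (∇ g u)) (psi lam α u) := by
  rw [hasGradientAt_iff_hasFDerivAt]
  have h1 : HasFDerivAt g (fderiv ℝ g u) (psiCLM lam (-α) (psi lam α u)) := by
    simpa [psi_psi] using hu.hasFDerivAt
  have h2 := (h1.comp (psi lam α u) (psiCLM lam (-α)).hasFDerivAt).const_mul (Real.exp α)
  have h3 : (fun w => Real.exp α * (g ∘ psiCLM lam (-α)) w) = g := by
    funext w
    rw [Function.comp_apply, psiCLM_apply, ← hq, psi_psi, add_neg_cancel, psi_zero]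
  rw [h3] at h2
  refine h2.congr_fderiv ?_
  ext v
  simp [inner_psi_left, inner_gradient_left]

theorem IsQuasiHomogeneous.smul_psi_mem_clarkeSubdiff (hq : IsQuasiHomogeneous lam g) (α : ℝ)
    {θ h : EuclideanSpace ℝ (Fin m)} (hh : h ∈ clarkeSubdiff g θ) :
    Real.exp α • psi lam (-α) h ∈ clarkeSubdiff g (psi lam α θ) := by
  have hconv := (convex_clarkeSubdiff g (psi lam α θ)).linear_preimage
    (Real.exp α • (psiCLM lam (-α)).toLinearMap)
  refine convexHull_min ?_ hconv hh
  rintro v ⟨u, hu, hd, hv⟩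
  refine subset_convexHull ℝ _ ⟨fun k => psi lam α (u k),
    ((psiCLM lam α).continuous.tendsto θ).comp hu,
    fun k => (hq.hasGradientAt_psi α (hd k)).differentiableAt, ?_⟩
  simp only [(hq.hasGradientAt_psi α (hd _)).gradient]
  exact (((psiCLM lam (-α)).continuous.tendsto v).comp hv).const_smul (Real.exp α)

end QuasiHomogeneous

/-! ### The two seminorms and normalization -/

section Seminorm

variable {m : ℕ} {lam : Fin m → ℝ}

theorem le_lamMax (lam : Fin m → ℝ) (j : Fin m) : lam j ≤ lamMax lam :=
  le_ciSup (Set.finite_range lam).bddAbove j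

theorem lamMax_pos (hlam : ∀ i, 0 ≤ lam i) (hne : lam ≠ 0) : 0 < lamMax lam := by
  obtain ⟨j, hj⟩ := Function.ne_iff.1 hne
  exact ((hlam j).lt_of_ne' hj).trans_le (le_lamMax lam j)

theorem lamMaxSeminormSq_le (hlam : ∀ i, 0 ≤ lam i) (u : EuclideanSpace ℝ (Fin m)) :
    lamMaxSeminormSq lam u ≤ lamSeminormSq lam u :=
  Finset.sum_le_sum_of_subset_of_nonneg (Finset.subset_univ _) fun i _ _ =>
    mul_nonneg (hlam i) (sq_nonneg _)

theorem lamMaxSeminormSq_psi (lam : Fin m → ℝ) (α : ℝ) (u : EuclideanSpace ℝ (Fin m)) :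
    lamMaxSeminormSq lam (psi lam α u)
      = Real.exp (2 * lamMax lam * α) * lamMaxSeminormSq lam u := by
  unfold lamMaxSeminormSq
  rw [Finset.mul_sum]
  refine Finset.sum_congr rfl fun j hj => ?_
  rw [(Finset.mem_filter.1 hj).2, psi_apply, (Finset.mem_filter.1 hj).2, mul_pow,
    ← Real.exp_nat_mul]
  push_cast
  rw [show 2 * (α * lamMax lam) = 2 * lamMax lam * α by ring]
  ring

theorem lamSeminormSq_psi (lam : Fin m → ℝ) (α : ℝ) (u : EuclideanSpace ℝ (Fin m)) :
    lamSeminormSq lam (psi lam α u) = ∑ j, Real.exp (2 * lam j * α) * (lam j * u j ^ 2) := by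
  unfold lamSeminormSq
  refine Finset.sum_congr rfl fun j _ => ?_
  rw [psi_apply, mul_pow, ← Real.exp_nat_mul]
  push_cast
  rw [show 2 * (α * lam j) = 2 * lam j * α by ring]
  ring

theorem lamSeminormSq_psi_le (hlam : ∀ i, 0 ≤ lam i) {α B : ℝ} (hB : 0 ≤ B) (hα : α ≤ B)
    (u : EuclideanSpace ℝ (Fin m)) :
    lamSeminormSq lam (psi lam α u)
      ≤ Real.exp (2 * lamMax lam * B) * lamSeminormSq lam u := by
  rw [lamSeminormSq_psi, lamSeminormSq, Finset.mul_sum]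
  refine Finset.sum_le_sum fun j _ => mul_le_mul_of_nonneg_right (Real.exp_le_exp.2 ?_)
    (mul_nonneg (hlam j) (sq_nonneg _))
  calc 2 * lam j * α ≤ 2 * lam j * B := by
        exact mul_le_mul_of_nonneg_left hα (by linarith [hlam j])
    _ ≤ 2 * lamMax lam * B := by
        exact mul_le_mul_of_nonneg_right (by linarith [le_lamMax lam j]) hB

theorem lamSeminormSq_lamNormalize (hlam : ∀ i, 0 ≤ lam i) {u : EuclideanSpace ℝ (Fin m)}
    (hu : 0 < lamSeminormSq lam u) : lamSeminormSq lam (lamNormalize lam u) = 1 := by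
  have h := (existsUnique_lamTau lam hlam u hu).exists
  rw [lamNormalize, lamTau, dif_pos h]
  exact h.choose_spec

theorem psi_lamTau_lamNormalize (lam : Fin m → ℝ) (u : EuclideanSpace ℝ (Fin m)) :
    psi lam (lamTau lam u) (lamNormalize lam u) = u := by
  rw [lamNormalize, psi_psi, add_neg_cancel, psi_zero]

theorem lamSeminormSq_nonneg (hlam : ∀ i, 0 ≤ lam i) (u : EuclideanSpace ℝ (Fin m)) :
    0 ≤ lamSeminormSq lam u :=
  Finset.sum_nonneg fun i _ => mul_nonneg (hlam i) (sq_nonneg _)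

/-- Even with the default value of `lamTau`, normalization only scales the top seminorm by a
positive factor, so positivity transfers back to u. -/
theorem lamSeminormSq_pos_of_lamMaxSeminormSq_lamNormalize_pos (hlam : ∀ i, 0 ≤ lam i)
    {u : EuclideanSpace ℝ (Fin m)} (hu : 0 < lamMaxSeminormSq lam (lamNormalize lam u)) :
    0 < lamSeminormSq lam u := by
  rw [lamNormalize, lamMaxSeminormSq_psi] at hu
  exact (pos_of_mul_pos_right hu (Real.exp_pos _).le).trans_le (lamMaxSeminormSq_le hlam u)

theorem norm_lamScale_sq_le (hlam : ∀ i, 0 ≤ lam i) (u : EuclideanSpace ℝ (Fin m)) :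
    ‖lamScale lam u‖ ^ 2 ≤ lamMax lam * lamSeminormSq lam u := by
  rw [EuclideanSpace.real_norm_sq_eq, lamSeminormSq, Finset.mul_sum]
  refine Finset.sum_le_sum fun j _ => ?_
  rw [lamScale_apply, mul_pow, sq (lam j), mul_assoc]
  exact mul_le_mul_of_nonneg_right (le_lamMax lam j) (mul_nonneg (hlam j) (sq_nonneg _))

theorem contDiff_lamSeminormSq (lam : Fin m → ℝ) : ContDiff ℝ 1 (lamSeminormSq lam) := by
  unfold lamSeminormSq
  fun_prop

theorem contDiff_lamMaxSeminormSq (lam : Fin m → ℝ) : ContDiff ℝ 1 (lamMaxSeminormSq lam) := by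
  unfold lamMaxSeminormSq
  fun_prop

theorem HasDerivAt.euclidean_apply {z : ℝ → EuclideanSpace ℝ (Fin m)}
    {z' : EuclideanSpace ℝ (Fin m)} {t : ℝ} (hz : HasDerivAt z z' t) (j : Fin m) :
    HasDerivAt (fun s => z s j) (z' j) t :=
  ((EuclideanSpace.proj j : EuclideanSpace ℝ (Fin m) →L[ℝ] ℝ).hasFDerivAt.comp_hasDerivAt t hz :)

theorem hasDerivAt_lamSeminormSq_comp {z : ℝ → EuclideanSpace ℝ (Fin m)}
    {z' : EuclideanSpace ℝ (Fin m)} {t : ℝ} (hz : HasDerivAt z z' t) :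
    HasDerivAt (fun s => lamSeminormSq lam (z s)) (2 * inner ℝ z' (lamScale lam (z t))) t := by
  have h1 : ∀ j ∈ Finset.univ, HasDerivAt (fun s => lam j * z s j ^ 2)
      (lam j * (2 * z t j ^ 1 * z' j)) t := fun j _ => by
    simpa using ((hz.euclidean_apply j).pow 2).const_mul (lam j)
  refine (HasDerivAt.fun_sum h1).congr_deriv ?_
  simp only [PiLp.inner_apply, lamScale_apply, RCLike.inner_apply, conj_trivial, Finset.mul_sum]
  exact Finset.sum_congr rfl fun j _ => by ring

end Seminorm

/-! ### Monotone quantities along the gradient flow -/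

section Flow

variable {d m n : ℕ} {f : EuclideanSpace ℝ (Fin d) → EuclideanSpace ℝ (Fin m) → ℝ}
  {x : Fin n → EuclideanSpace ℝ (Fin d)} {y : Fin n → ℝ} {lam : Fin m → ℝ}
  {θ : ℝ → EuclideanSpace ℝ (Fin m)} {t t₀ : ℝ} {h : Fin n → EuclideanSpace ℝ (Fin m)}

/-- At time `t` the arc `θ` is differentiable, its velocity is the negative subgradient of the loss
assembled from the subgradients `h i` of the outputs, and the chain rule holds along each `h i`. -/
structure IsFlowVelocity (f : EuclideanSpace ℝ (Fin d) → EuclideanSpace ℝ (Fin m) → ℝ)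
    (x : Fin n → EuclideanSpace ℝ (Fin d)) (y : Fin n → ℝ) (θ : ℝ → EuclideanSpace ℝ (Fin m))
    (t : ℝ) (h : Fin n → EuclideanSpace ℝ (Fin m)) : Prop where
  differentiableAt : DifferentiableAt ℝ θ t
  mem : ∀ i, h i ∈ clarkeSubdiff (f (x i)) (θ t)
  deriv_eq : deriv θ t = -∑ i, lossCoeff f x y (θ t) i • h i
  hasDerivAt : ∀ i, HasDerivAt (fun s => f (x i) (θ s)) (inner ℝ (h i) (deriv θ t)) t

theorem IsArc.ae_differentiableAt (hθ : IsArc θ) :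
    ∀ᵐ t ∂(volume.restrict (Ioi (0 : ℝ))), DifferentiableAt ℝ θ t := by
  rw [ae_restrict_iff' measurableSet_Ioi]
  have h1 : ∀ᵐ t : ℝ, ∀ N : ℕ, t ∈ uIcc 0 ((N : ℝ) + 1) → DifferentiableAt ℝ θ t :=
    ae_all_iff.2 fun N => (hθ (N + 1) (by positivity)).ae_differentiableAt_vector
  filter_upwards [h1] with t ht hpos
  obtain ⟨N, hN⟩ := exists_nat_ge t
  refine ht N ?_
  rw [uIcc_of_le (by positivity)]
  exact ⟨le_of_lt hpos, by linarith⟩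

theorem IsArc.absolutelyContinuousOnInterval (hθ : IsArc θ) {a b : ℝ} (ha : 0 ≤ a) (hab : a ≤ b) :
    AbsolutelyContinuousOnInterval θ a b := by
  refine (hθ (b + 1) (by linarith)).mono ?_
  rw [uIcc_of_le hab, uIcc_of_le (by linarith)]
  exact Icc_subset_Icc ha (by linarith)

theorem IsGradientFlow.ae_exists_isFlowVelocity (hflow : IsGradientFlow (expLoss f x y) θ)
    (hlip : ∀ a, LocallyLipschitz (f a)) (hchain : ∀ a, AdmitsChainRule (f a)) :
    ∀ᵐ t ∂(volume.restrict (Ioi (0 : ℝ))), ∃ h, IsFlowVelocity f x y θ t h := by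
  filter_upwards [hflow.1.ae_differentiableAt, hflow.2,
    ae_all_iff.2 fun i => hchain (x i) θ hflow.1] with t hd hmem hc
  obtain ⟨h, hh, hsum⟩ := exists_eq_sum_lossCoeff_of_mem_clarkeSubdiff hlip hchain hmem
  exact ⟨h, hd, hh, by rw [← hsum, neg_neg], fun i => hc i (h i) (hh i)⟩

theorem antitoneOn_of_ae_hasDerivAt_nonpos {F : ℝ → ℝ} (ht₀ : 0 ≤ t₀)
    (hac : ∀ a b, t₀ ≤ a → a ≤ b → AbsolutelyContinuousOnInterval F a b)
    (hF : ∀ᵐ t ∂(volume.restrict (Ioi (0 : ℝ))), t₀ < t → ∃ F' ≤ 0, HasDerivAt F F' t) :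
    AntitoneOn F (Ici t₀) := by
  intro a ha b _ hab
  rw [ae_restrict_iff' measurableSet_Ioi] at hF
  refine (hac a b ha hab).le_of_ae_hasDerivAt_nonpos hab ?_
  filter_upwards [hF] with t ht hmem
  have h1 : t₀ < t := lt_of_le_of_lt ha hmem.1
  exact ht (lt_of_le_of_lt ht₀ h1) h1

/-- The rate `⟨Λ θ, θ'⟩` along the flow. -/
def lossRate (f : EuclideanSpace ℝ (Fin d) → EuclideanSpace ℝ (Fin m) → ℝ)
    (x : Fin n → EuclideanSpace ℝ (Fin d)) (y : Fin n → ℝ) (u : EuclideanSpace ℝ (Fin m)) : ℝ :=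
  (1 / (n : ℝ)) * ∑ i, Real.exp (-(y i * f (x i) u)) * (y i * f (x i) u)

theorem IsFlowVelocity.inner_lamScale (hv : IsFlowVelocity f x y θ t h)
    (hquasi : ∀ a, IsQuasiHomogeneous lam (f a)) (hlip : ∀ a, LocallyLipschitz (f a)) :
    inner ℝ (deriv θ t) (lamScale lam (θ t)) = lossRate f x y (θ t) := by
  rw [hv.deriv_eq, inner_neg_left, sum_inner, lossRate, Finset.mul_sum, ← Finset.sum_neg_distrib]
  refine Finset.sum_congr rfl fun i _ => ?_
  rw [real_inner_smul_left, (hquasi (x i)).inner_lamScale (hlip (x i)).continuous (hv.mem i),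
    lossCoeff]
  ring

theorem IsFlowVelocity.hasDerivAt_lamSeminormSq (hv : IsFlowVelocity f x y θ t h)
    (hquasi : ∀ a, IsQuasiHomogeneous lam (f a)) (hlip : ∀ a, LocallyLipschitz (f a)) :
    HasDerivAt (fun s => lamSeminormSq lam (θ s)) (2 * lossRate f x y (θ t)) t := by
  rw [← hv.inner_lamScale hquasi hlip]
  exact hasDerivAt_lamSeminormSq_comp hv.differentiableAt.hasDerivAt

theorem IsFlowVelocity.hasDerivAt_expLoss (hv : IsFlowVelocity f x y θ t h) :
    HasDerivAt (fun s => expLoss f x y (θ s)) (-‖deriv θ t‖ ^ 2) t := by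
  refine (hasDerivAt_expLoss_comp hv.hasDerivAt).congr_deriv ?_
  rw [← neg_neg (∑ i, _), ← hv.deriv_eq, inner_neg_left, real_inner_self_eq_norm_sq]

theorem antitoneOn_expLoss (hflow : IsGradientFlow (expLoss f x y) θ)
    (hlip : ∀ a, LocallyLipschitz (f a)) (hchain : ∀ a, AdmitsChainRule (f a)) :
    AntitoneOn (fun t => expLoss f x y (θ t)) (Ici 0) := by
  refine antitoneOn_of_ae_hasDerivAt_nonpos le_rfl (fun a b ha hab =>
    (hflow.1.absolutelyContinuousOnInterval ha hab).expLoss_comp hlip) ?_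
  filter_upwards [hflow.ae_exists_isFlowVelocity hlip hchain] with t ⟨h, hv⟩ _
  exact ⟨_, neg_nonpos.2 (sq_nonneg _), hv.hasDerivAt_expLoss⟩

/-- The logarithmic smoothed margin `log (1 / (n L))`. -/
def smoothMargin (f : EuclideanSpace ℝ (Fin d) → EuclideanSpace ℝ (Fin m) → ℝ)
    (x : Fin n → EuclideanSpace ℝ (Fin d)) (y : Fin n → ℝ) (u : EuclideanSpace ℝ (Fin m)) : ℝ :=
  -Real.log (n * expLoss f x y u)

theorem mul_expLoss (hn : 0 < n) (u : EuclideanSpace ℝ (Fin m)) :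
    n * expLoss f x y u = ∑ i, Real.exp (-(y i * f (x i) u)) := by
  have : (n : ℝ) ≠ 0 := by positivity
  rw [expLoss, ← mul_assoc, mul_one_div_cancel this, one_mul]

theorem expLoss_pos (hn : 0 < n) (u : EuclideanSpace ℝ (Fin m)) : 0 < expLoss f x y u := by
  have : Nonempty (Fin n) := ⟨⟨0, hn⟩⟩
  exact mul_pos (by positivity) (Finset.sum_pos (fun i _ => Real.exp_pos _)
    Finset.univ_nonempty)

/-- A single exponential is at most the whole sum: the smoothed margin is a softmin. -/
theorem smoothMargin_le (hn : 0 < n) (u : EuclideanSpace ℝ (Fin m)) (i : Fin n) :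
    smoothMargin f x y u ≤ y i * f (x i) u := by
  have h1 : Real.exp (-(y i * f (x i) u)) ≤ n * expLoss f x y u := by
    rw [mul_expLoss hn]
    exact Finset.single_le_sum (f := fun i => Real.exp (-(y i * f (x i) u)))
      (fun i _ => (Real.exp_pos _).le) (Finset.mem_univ i)
  have h2 := Real.log_le_log (Real.exp_pos _) h1
  rw [Real.log_exp] at h2
  rw [smoothMargin]
  linarith

theorem smoothMargin_pos (hn : 0 < n) {u : EuclideanSpace ℝ (Fin m)}
    (hu : expLoss f x y u < (n : ℝ)⁻¹) : 0 < smoothMargin f x y u := by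
  have hn' : (0 : ℝ) < n := by positivity
  refine neg_pos.2 (Real.log_neg (mul_pos hn' (expLoss_pos hn u)) ?_)
  calc n * expLoss f x y u < n * (n : ℝ)⁻¹ := by gcongr
    _ = 1 := mul_inv_cancel₀ hn'.ne'

theorem expLoss_mul_smoothMargin_le (hn : 0 < n) (u : EuclideanSpace ℝ (Fin m)) :
    expLoss f x y u * smoothMargin f x y u ≤ lossRate f x y u := by
  rw [expLoss, lossRate, mul_assoc, Finset.sum_mul]
  refine mul_le_mul_of_nonneg_left (Finset.sum_le_sum fun i _ => ?_) (by positivity)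
  exact mul_le_mul_of_nonneg_left (smoothMargin_le hn u i) (Real.exp_pos _).le

theorem IsFlowVelocity.hasDerivAt_smoothMargin (hn : 0 < n) (hv : IsFlowVelocity f x y θ t h) :
    HasDerivAt (fun s => smoothMargin f x y (θ s))
      (‖deriv θ t‖ ^ 2 / expLoss f x y (θ t)) t := by
  have hn' : (0 : ℝ) < n := by positivity
  have hL := expLoss_pos (f := f) (x := x) (y := y) hn (θ t)
  refine ((hv.hasDerivAt_expLoss.const_mul (n : ℝ)).log (mul_pos hn' hL).ne').fun_neg.congr_deriv ?_
  field_simp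

theorem AbsolutelyContinuousOnInterval.smoothMargin_comp (hn : 0 < n)
    (hlip : ∀ a, LocallyLipschitz (f a)) {a b : ℝ} (hz : AbsolutelyContinuousOnInterval θ a b) :
    AbsolutelyContinuousOnInterval (fun t => smoothMargin f x y (θ t)) a b := by
  have hn' : (n : ℝ) ≠ 0 := by positivity
  refine (hz.expLoss_comp (x := x) (y := y) hlip).comp_contDiffAt
    (G := fun r => -Real.log (n * r)) fun t _ => ?_
  have : (n : ℝ) * expLoss f x y (θ t) ≠ 0 := mul_ne_zero hn' (expLoss_pos hn _).ne'
  exact ((contDiffAt_const.mul contDiffAt_id).log this).neg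

/-- The margin normalized by the `Λ`-seminorm does not decrease along the flow. -/
theorem antitoneOn_log_lamSeminormSq_sub_log_smoothMargin (hn : 0 < n)
    (hlam : ∀ i, 0 ≤ lam i) (hne : lam ≠ 0)
    (hquasi : ∀ a, IsQuasiHomogeneous lam (f a)) (hlip : ∀ a, LocallyLipschitz (f a))
    (hchain : ∀ a, AdmitsChainRule (f a)) (hflow : IsGradientFlow (expLoss f x y) θ)
    (ht₀ : 0 ≤ t₀) (hℓ : ∀ t, t₀ ≤ t → 0 < smoothMargin f x y (θ t))
    (hS : ∀ t, t₀ ≤ t → 0 < lamSeminormSq lam (θ t)) :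
    AntitoneOn (fun t => Real.log (lamSeminormSq lam (θ t)) * (2 * lamMax lam)⁻¹
      - Real.log (smoothMargin f x y (θ t))) (Ici t₀) := by
  have hM := lamMax_pos hlam hne
  refine antitoneOn_of_ae_hasDerivAt_nonpos ht₀ (fun a b ha hab => ?_) ?_
  · have hac := hflow.1.absolutelyContinuousOnInterval (ht₀.trans ha) hab
    refine AbsolutelyContinuousOnInterval.fun_sub ?_ ?_
    · refine hac.comp_contDiffAt
        (G := fun u => Real.log (lamSeminormSq lam u) * (2 * lamMax lam)⁻¹) fun t ht => ?_
      rw [uIcc_of_le hab] at ht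
      exact ((contDiff_lamSeminormSq lam).contDiffAt.log (hS t (ha.trans ht.1)).ne').mul
        contDiffAt_const
    · refine (hac.smoothMargin_comp (x := x) (y := y) hn hlip).comp_contDiffAt
        (G := Real.log) fun t ht => ?_
      rw [uIcc_of_le hab] at ht
      exact Real.contDiffAt_log.2 (hℓ t (ha.trans ht.1)).ne'
  · filter_upwards [hflow.ae_exists_isFlowVelocity hlip hchain] with t ⟨h, hv⟩ ht
    have hSt := hS t ht.le
    have hℓt := hℓ t ht.le
    have hL := expLoss_pos (f := f) (x := x) (y := y) hn (θ t)
    refine ⟨_, ?_, (((hv.hasDerivAt_lamSeminormSq hquasi hlip).log hSt.ne').mul_const _).fun_sub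
      ((hv.hasDerivAt_smoothMargin hn).log hℓt.ne')⟩
    set S := lamSeminormSq lam (θ t)
    set ℓ := smoothMargin f x y (θ t)
    set L := expLoss f x y (θ t)
    set P := lossRate f x y (θ t) with hP
    have h1 : L * ℓ ≤ P := expLoss_mul_smoothMargin_le hn (θ t)
    have hLℓ : 0 < L * ℓ := mul_pos hL hℓt
    -- Cauchy–Schwarz for P = ⟨θ', Λθ⟩, with |Λθ|² ≤ λ_max S. Together with 0 < Lℓ ≤ P it gives P L
    -- ℓ ≤ |θ'|² λ_max S, the sign required of the derivative.
    have h2 : P ^ 2 ≤ ‖deriv θ t‖ ^ 2 * (lamMax lam * S) := by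
      calc P ^ 2 ≤ (‖deriv θ t‖ * ‖lamScale lam (θ t)‖) ^ 2 := by
            rw [hP, ← hv.inner_lamScale hquasi hlip]
            refine sq_le_sq' ?_ (real_inner_le_norm _ _)
            exact neg_le_of_abs_le (abs_real_inner_le_norm _ _)
        _ ≤ _ := by
            rw [mul_pow]
            exact mul_le_mul_of_nonneg_left (norm_lamScale_sq_le hlam (θ t)) (sq_nonneg _)
    rw [sub_nonpos, div_div]
    have h3 : 2 * P / S * (2 * lamMax lam)⁻¹ = P / (lamMax lam * S) := by
      field_simp
    rw [h3, div_le_div_iff₀ (mul_pos hM hSt) hLℓ]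
    nlinarith

end Flow

/-! ### Positive normalized margin and divergence of the parameters -/

section Divergence

variable {d m n : ℕ} {f : EuclideanSpace ℝ (Fin d) → EuclideanSpace ℝ (Fin m) → ℝ}
  {x : Fin n → EuclideanSpace ℝ (Fin d)} {y : Fin n → ℝ} {lam : Fin m → ℝ}
  {θ : ℝ → EuclideanSpace ℝ (Fin m)} {t₀ : ℝ} {θlim : EuclideanSpace ℝ (Fin m)}

theorem apply_eq_exp_lamTau_mul (hquasi : ∀ a, IsQuasiHomogeneous lam (f a))
    (a : EuclideanSpace ℝ (Fin d)) (u : EuclideanSpace ℝ (Fin m)) :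
    f a u = Real.exp (lamTau lam u) * f a (lamNormalize lam u) := by
  rw [← hquasi a, psi_lamTau_lamNormalize]

theorem exp_mul_le_lamSeminormSq (hlam : ∀ i, 0 ≤ lam i) {κ : ℝ} {u : EuclideanSpace ℝ (Fin m)}
    (hu : κ ≤ lamMaxSeminormSq lam (lamNormalize lam u)) :
    Real.exp (2 * lamMax lam * lamTau lam u) * κ ≤ lamSeminormSq lam u := by
  refine le_trans ?_ (lamMaxSeminormSq_le hlam u)
  rw [← psi_lamTau_lamNormalize lam u, lamMaxSeminormSq_psi, psi_lamTau_lamNormalize]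
  exact mul_le_mul_of_nonneg_left hu (Real.exp_pos _).le

/-- The normalized parameters keep a positive margin. -/
theorem exists_pos_le_margin_lamNormalize (hn : 0 < n) (hlam : ∀ i, 0 ≤ lam i) (hne : lam ≠ 0)
    (hquasi : ∀ a, IsQuasiHomogeneous lam (f a)) (hlip : ∀ a, LocallyLipschitz (f a))
    (hchain : ∀ a, AdmitsChainRule (f a)) (hflow : IsGradientFlow (expLoss f x y) θ)
    (ht₀ : 0 ≤ t₀) (hℓ : ∀ t, t₀ ≤ t → 0 < smoothMargin f x y (θ t)) {κ : ℝ} (hκ : 0 < κ)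
    (hκθ : ∀ t, t₀ ≤ t → κ ≤ lamMaxSeminormSq lam (lamNormalize lam (θ t))) :
    ∃ c > 0, ∀ t, t₀ ≤ t → ∀ i, c ≤ y i * f (x i) (lamNormalize lam (θ t)) := by
  have hM := lamMax_pos hlam hne
  have hS : ∀ t, t₀ ≤ t → 0 < lamSeminormSq lam (θ t) := fun t ht =>
    (mul_pos (Real.exp_pos _) hκ).trans_le (exp_mul_le_lamSeminormSq hlam (hκθ t ht))
  have hmono := antitoneOn_log_lamSeminormSq_sub_log_smoothMargin hn hlam hne hquasi hlip hchain
    hflow ht₀ hℓ hS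
  set C := Real.log (lamSeminormSq lam (θ t₀)) * (2 * lamMax lam)⁻¹
      - Real.log (smoothMargin f x y (θ t₀)) with hC
  refine ⟨Real.exp (Real.log κ * (2 * lamMax lam)⁻¹ - C), Real.exp_pos _, fun t ht i => ?_⟩
  have h1 : Real.log (lamSeminormSq lam (θ t)) * (2 * lamMax lam)⁻¹
      - Real.log (smoothMargin f x y (θ t)) ≤ C := hmono self_mem_Ici ht ht
  have h2 := Real.log_le_log (mul_pos (Real.exp_pos _) hκ)
    (exp_mul_le_lamSeminormSq hlam (hκθ t ht))
  rw [Real.log_mul (Real.exp_pos _).ne' hκ.ne', Real.log_exp] at h2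
  have h3 : lamTau lam (θ t) + Real.log κ * (2 * lamMax lam)⁻¹
      ≤ Real.log (lamSeminormSq lam (θ t)) * (2 * lamMax lam)⁻¹ := by
    refine le_trans (le_of_eq ?_) (mul_le_mul_of_nonneg_right h2 (by positivity))
    field_simp
  have h4 : lamTau lam (θ t) + (Real.log κ * (2 * lamMax lam)⁻¹ - C)
      ≤ Real.log (smoothMargin f x y (θ t)) := by linarith
  have h5 := (Real.le_log_iff_exp_le (hℓ t ht)).1 h4
  rw [Real.exp_add] at h5
  have h6 := h5.trans (smoothMargin_le hn (θ t) i)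
  rw [apply_eq_exp_lamTau_mul hquasi (x i) (θ t), mul_left_comm] at h6
  exact le_of_mul_le_mul_left h6 (Real.exp_pos _)

theorem lossRate_pos (hn : 0 < n) {u : EuclideanSpace ℝ (Fin m)}
    (hu : 0 < smoothMargin f x y u) : 0 < lossRate f x y u :=
  (mul_pos (expLoss_pos hn u) hu).trans_le (expLoss_mul_smoothMargin_le hn u)

theorem antitoneOn_mul_sub_lamSeminormSq (hquasi : ∀ a, IsQuasiHomogeneous lam (f a))
    (hlip : ∀ a, LocallyLipschitz (f a)) (hchain : ∀ a, AdmitsChainRule (f a))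
    (hflow : IsGradientFlow (expLoss f x y) θ) (ht₀ : 0 ≤ t₀) {c : ℝ}
    (hc : ∀ t, t₀ ≤ t → c ≤ lossRate f x y (θ t)) :
    AntitoneOn (fun t => 2 * c * t - lamSeminormSq lam (θ t)) (Ici t₀) := by
  refine antitoneOn_of_ae_hasDerivAt_nonpos ht₀ (fun a b ha hab => ?_) ?_
  · refine AbsolutelyContinuousOnInterval.fun_sub
      (ContDiffOn.absolutelyContinuousOnInterval (ContDiff.contDiffOn (by fun_prop))) ?_
    exact (hflow.1.absolutelyContinuousOnInterval (ht₀.trans ha) hab).comp_contDiffAt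
      fun t _ => (contDiff_lamSeminormSq lam).contDiffAt
  · filter_upwards [hflow.ae_exists_isFlowVelocity hlip hchain] with t ⟨h, hv⟩ ht
    refine ⟨_, ?_, ((hasDerivAt_id' t).const_mul (2 * c)).fun_sub
      (hv.hasDerivAt_lamSeminormSq hquasi hlip)⟩
    linarith [hc t ht.le]

/-- S increases, as its derivative is twice the positive `lossRate`. If S stayed bounded, so would τ
and hence one margin; the loss, and with it `lossRate`, would be bounded below, forcing linear
growth. -/
theorem tendsto_lamSeminormSq_atTop (hn : 0 < n) (hlam : ∀ i, 0 ≤ lam i) (hne : lam ≠ 0)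
    (hquasi : ∀ a, IsQuasiHomogeneous lam (f a)) (hlip : ∀ a, LocallyLipschitz (f a))
    (hchain : ∀ a, AdmitsChainRule (f a)) (hflow : IsGradientFlow (expLoss f x y) θ)
    (ht₀ : 0 ≤ t₀) (hL : ∀ t, t₀ ≤ t → expLoss f x y (θ t) ≤ expLoss f x y (θ t₀))
    (hℓ : ∀ t, t₀ ≤ t → 0 < smoothMargin f x y (θ t)) {κ : ℝ} (hκ : 0 < κ)
    (hκθ : ∀ t, t₀ ≤ t → κ ≤ lamMaxSeminormSq lam (lamNormalize lam (θ t)))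
    (hconv : Tendsto (fun t => lamNormalize lam (θ t)) atTop (𝓝 θlim)) :
    Tendsto (fun t => lamSeminormSq lam (θ t)) atTop atTop := by
  have hM := lamMax_pos hlam hne
  have hn' : (0 : ℝ) < n := by positivity
  have hmono : ∀ a b, t₀ ≤ a → a ≤ b → lamSeminormSq lam (θ a) ≤ lamSeminormSq lam (θ b) := by
    intro a b ha hab
    have h1 := antitoneOn_mul_sub_lamSeminormSq hquasi hlip hchain hflow (ht₀.trans ha) (c := 0)
      (fun t ht => (lossRate_pos hn (hℓ t (ha.trans ht))).le) self_mem_Ici hab hab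
    simp only [mul_zero, zero_mul, zero_sub] at h1
    linarith
  rw [tendsto_atTop]
  intro B
  by_contra hB
  have hbound : ∀ t, t₀ ≤ t → lamSeminormSq lam (θ t) < B := by
    intro t ht
    by_contra hle
    exact hB (eventually_atTop.2 ⟨t, fun s hs => (not_lt.1 hle).trans (hmono t s ht hs)⟩)
  have hBpos : 0 < B := (lamSeminormSq_nonneg hlam _).trans_lt (hbound t₀ le_rfl)
  have hτ : ∀ t, t₀ ≤ t → Real.exp (lamTau lam (θ t))
      ≤ Real.exp ((2 * lamMax lam)⁻¹ * Real.log (B / κ)) := by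
    intro t ht
    have h1 := (exp_mul_le_lamSeminormSq hlam (hκθ t ht)).trans (hbound t ht).le
    rw [← le_div_iff₀ hκ, ← Real.le_log_iff_exp_le (by positivity)] at h1
    rw [Real.exp_le_exp, inv_mul_eq_div, le_div_iff₀ (by positivity)]
    linarith
  set i₀ : Fin n := ⟨0, hn⟩
  have hq : Tendsto (fun t => y i₀ * f (x i₀) (lamNormalize lam (θ t))) atTop
      (𝓝 (y i₀ * f (x i₀) θlim)) :=
    (((hlip (x i₀)).continuous.tendsto θlim).comp hconv).const_mul _
  obtain ⟨T, hT⟩ := eventually_atTop.1 (hq.eventually (gt_mem_nhds (lt_add_one _)))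
  set q := |y i₀ * f (x i₀) θlim + 1|
  set c := 1 / n * Real.exp (-(Real.exp ((2 * lamMax lam)⁻¹ * Real.log (B / κ)) * q))
    * smoothMargin f x y (θ t₀)
  have hc : 0 < c := mul_pos (by positivity) (hℓ t₀ le_rfl)
  have hrate : ∀ t, max t₀ T ≤ t → c ≤ lossRate f x y (θ t) := by
    intro t ht
    have ht₀t := (le_max_left _ _).trans ht
    refine le_trans ?_ (expLoss_mul_smoothMargin_le hn (θ t))
    refine mul_le_mul ?_ ?_ (hℓ t₀ le_rfl).le (expLoss_pos hn _).le
    · rw [expLoss]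
      refine mul_le_mul_of_nonneg_left ?_ (by positivity)
      refine le_trans (Real.exp_le_exp.2 (neg_le_neg ?_)) (Finset.single_le_sum
        (f := fun i => Real.exp (-(y i * f (x i) (θ t)))) (fun i _ => (Real.exp_pos _).le)
        (Finset.mem_univ i₀))
      rw [apply_eq_exp_lamTau_mul hquasi, mul_left_comm]
      calc Real.exp (lamTau lam (θ t)) * (y i₀ * f (x i₀) (lamNormalize lam (θ t)))
          ≤ Real.exp (lamTau lam (θ t)) * q := by
            refine mul_le_mul_of_nonneg_left ?_ (Real.exp_pos _).le
            exact (hT t ((le_max_right _ _).trans ht)).le.trans (le_abs_self _)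
        _ ≤ _ := mul_le_mul_of_nonneg_right (hτ t ht₀t) (abs_nonneg _)
    · refine neg_le_neg (Real.log_le_log (mul_pos hn' (expLoss_pos hn _)) ?_)
      exact mul_le_mul_of_nonneg_left (hL t ht₀t) hn'.le
  have hgrow := antitoneOn_mul_sub_lamSeminormSq hquasi hlip hchain hflow
    (ht₀.trans (le_max_left t₀ T)) hrate
  -- After a further time B / (2c), S has grown by at least B from a nonnegative value, against S <
  -- B.
  have hs : max t₀ T ≤ max t₀ T + B / (2 * c) := by
    have : 0 < B / (2 * c) := by positivity
    linarith
  have h1 := hgrow self_mem_Ici hs hs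
  have h2 := hbound _ ((le_max_left t₀ T).trans hs)
  have h3 := lamSeminormSq_nonneg hlam (θ (max t₀ T))
  have h4 : 2 * c * (max t₀ T + B / (2 * c)) = 2 * c * max t₀ T + B := by
    field_simp
  simp only [h4] at h1
  linarith

theorem tendsto_lamTau_atTop (hlam : ∀ i, 0 ≤ lam i) {ι : Type*} {l : Filter ι}
    {u : ι → EuclideanSpace ℝ (Fin m)}
    (hu : Tendsto (fun t => lamSeminormSq lam (u t)) l atTop) :
    Tendsto (fun t => lamTau lam (u t)) l atTop := by
  refine tendsto_atTop.2 fun B => ?_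
  filter_upwards [hu.eventually_gt_atTop (Real.exp (2 * lamMax lam * max B 0)),
    hu.eventually_gt_atTop 0] with t ht hpos
  by_contra hlt
  have h1 := lamSeminormSq_psi_le hlam (le_max_right B 0)
    ((not_le.1 hlt).le.trans (le_max_left B 0)) (lamNormalize lam (u t))
  rw [psi_lamTau_lamNormalize, lamSeminormSq_lamNormalize hlam hpos, mul_one] at h1
  exact absurd ht (not_lt.2 h1)

end Divergence

/-! ### Softmin weights, the exponent ρ, and a converse of L'Hôpital's rule -/

section DirectionalConvergence

variable {d m n : ℕ} {f : EuclideanSpace ℝ (Fin d) → EuclideanSpace ℝ (Fin m) → ℝ}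
  {x : Fin n → EuclideanSpace ℝ (Fin d)} {y : Fin n → ℝ} {lam : Fin m → ℝ}
  {θ : ℝ → EuclideanSpace ℝ (Fin m)} {t t₀ : ℝ} {θlim : EuclideanSpace ℝ (Fin m)}

/-- The softmin weights of the margins. -/
def lossWeight (f : EuclideanSpace ℝ (Fin d) → EuclideanSpace ℝ (Fin m) → ℝ)
    (x : Fin n → EuclideanSpace ℝ (Fin d)) (y : Fin n → ℝ) (u : EuclideanSpace ℝ (Fin m))
    (i : Fin n) : ℝ :=
  Real.exp (-(y i * f (x i) u)) / ∑ k, Real.exp (-(y k * f (x k) u))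

theorem sum_exp_neg_margin_pos (hn : 0 < n) (u : EuclideanSpace ℝ (Fin m)) :
    0 < ∑ k, Real.exp (-(y k * f (x k) u)) := by
  have : Nonempty (Fin n) := ⟨⟨0, hn⟩⟩
  exact Finset.sum_pos (fun i _ => Real.exp_pos _) Finset.univ_nonempty

theorem lossWeight_mem_stdSimplex (hn : 0 < n) (u : EuclideanSpace ℝ (Fin m)) :
    lossWeight f x y u ∈ stdSimplex ℝ (Fin n) := by
  refine ⟨fun i => div_nonneg (Real.exp_pos _).le (sum_exp_neg_margin_pos hn u).le, ?_⟩
  simp only [lossWeight, ← Finset.sum_div]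
  exact div_self (sum_exp_neg_margin_pos hn u).ne'

theorem expLoss_mul_lossWeight (hn : 0 < n) (u : EuclideanSpace ℝ (Fin m)) (i : Fin n) :
    expLoss f x y u * lossWeight f x y u i = 1 / (n : ℝ) * Real.exp (-(y i * f (x i) u)) := by
  rw [expLoss, lossWeight, mul_assoc, mul_div_cancel₀ _ (sum_exp_neg_margin_pos hn u).ne']

theorem lossWeight_le (u : EuclideanSpace ℝ (Fin m)) (i j : Fin n) :
    lossWeight f x y u i ≤ Real.exp (y j * f (x j) u - y i * f (x i) u) := by
  rw [lossWeight, show y j * f (x j) u - y i * f (x i) u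
    = -(y i * f (x i) u) - -(y j * f (x j) u) by ring, Real.exp_sub]
  exact div_le_div_of_nonneg_left (Real.exp_pos _).le (Real.exp_pos _)
    (Finset.single_le_sum (f := fun k => Real.exp (-(y k * f (x k) u)))
      (fun k _ => (Real.exp_pos _).le) (Finset.mem_univ j))

theorem lossRate_eq (hn : 0 < n) (hquasi : ∀ a, IsQuasiHomogeneous lam (f a))
    (u : EuclideanSpace ℝ (Fin m)) :
    lossRate f x y u = expLoss f x y u * Real.exp (lamTau lam u) *
      ∑ i, lossWeight f x y u i * (y i * f (x i) (lamNormalize lam u)) := by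
  rw [lossRate, Finset.mul_sum, Finset.mul_sum]
  refine Finset.sum_congr rfl fun i _ => ?_
  rw [← mul_assoc, ← expLoss_mul_lossWeight hn]
  rw [apply_eq_exp_lamTau_mul hquasi (x i) u]
  ring

/-- Equivariance moves the subgradients from θ to θ̂, where they remain bounded as θ̂ converges. The
price is the coordinate-dependent factor e^{-λ_j τ}. -/
theorem IsFlowVelocity.exists_deriv_apply_eq (hn : 0 < n)
    (hquasi : ∀ a, IsQuasiHomogeneous lam (f a)) {h : Fin n → EuclideanSpace ℝ (Fin m)}
    (hv : IsFlowVelocity f x y θ t h) :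
    ∃ k : Fin n → EuclideanSpace ℝ (Fin m),
      (∀ i, k i ∈ clarkeSubdiff (f (x i)) (lamNormalize lam (θ t))) ∧
      ∀ j, deriv θ t j = expLoss f x y (θ t) * Real.exp (lamTau lam (θ t)) *
        Real.exp (-(lam j * lamTau lam (θ t))) *
        (∑ i, (lossWeight f x y (θ t) i * y i) • k i) j := by
  refine ⟨fun i => Real.exp (-lamTau lam (θ t)) • psi lam (- -lamTau lam (θ t)) (h i), fun i =>
    (hquasi (x i)).smul_psi_mem_clarkeSubdiff _ (hv.mem i), fun j => ?_⟩
  simp only [hv.deriv_eq, PiLp.neg_apply, WithLp.ofLp_sum, Finset.sum_apply, PiLp.smul_apply,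
    smul_eq_mul, psi_apply, neg_neg]
  rw [Finset.mul_sum, ← Finset.sum_neg_distrib]
  refine Finset.sum_congr rfl fun i _ => ?_
  rw [lossCoeff, ← expLoss_mul_lossWeight hn]
  have h1 : Real.exp (lamTau lam (θ t)) * Real.exp (-lamTau lam (θ t)) = 1 := by
    rw [← Real.exp_add, add_neg_cancel, Real.exp_zero]
  have h2 : Real.exp (-(lam j * lamTau lam (θ t))) * Real.exp (lamTau lam (θ t) * lam j) = 1 := by
    rw [← Real.exp_add, mul_comm, neg_add_cancel, Real.exp_zero]
  linear_combination (-(expLoss f x y (θ t) * lossWeight f x y (θ t) i * y i * h i j)) *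
    (Real.exp (-(lam j * lamTau lam (θ t))) * Real.exp (lamTau lam (θ t) * lam j) * h1 + h2)

open Classical in
/-- The projection onto the coordinates with maximal rate. -/
def topProj (lam : Fin m → ℝ) (u : EuclideanSpace ℝ (Fin m)) : EuclideanSpace ℝ (Fin m) :=
  WithLp.toLp 2 fun j => if lam j = lamMax lam then u j else 0

theorem topProj_apply_of_eq {j : Fin m} (hj : lam j = lamMax lam) (u : EuclideanSpace ℝ (Fin m)) :
    topProj lam u j = u j := if_pos hj

theorem topProj_apply_of_ne {j : Fin m} (hj : lam j ≠ lamMax lam) (u : EuclideanSpace ℝ (Fin m)) :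
    topProj lam u j = 0 := if_neg hj

theorem lamMaxSeminormSq_eq_sum (lam : Fin m → ℝ) (u : EuclideanSpace ℝ (Fin m)) :
    lamMaxSeminormSq lam u = ∑ j, lam j * topProj lam u j ^ 2 := by
  rw [lamMaxSeminormSq, Finset.sum_filter]
  refine Finset.sum_congr rfl fun j _ => ?_
  by_cases hj : lam j = lamMax lam
  · rw [if_pos hj, topProj_apply_of_eq hj]
  · rw [if_neg hj, topProj_apply_of_ne hj]
    simp

theorem gradient_half_lamMaxSeminormSq (lam : Fin m → ℝ) (u : EuclideanSpace ℝ (Fin m)) :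
    ∇ (fun ϑ => (1 / 2 : ℝ) * lamMaxSeminormSq lam ϑ) u = lamMax lam • topProj lam u := by
  refine HasGradientAt.gradient ?_
  rw [hasGradientAt_iff_hasFDerivAt]
  unfold lamMaxSeminormSq
  have h1 : ∀ j : Fin m, HasFDerivAt (fun ϑ : EuclideanSpace ℝ (Fin m) => ϑ j)
      (EuclideanSpace.proj j : EuclideanSpace ℝ (Fin m) →L[ℝ] ℝ) u := fun j =>
    (EuclideanSpace.proj j : EuclideanSpace ℝ (Fin m) →L[ℝ] ℝ).hasFDerivAt
  refine ((HasFDerivAt.fun_sum fun j _ => ((h1 j).pow 2).const_mul (lam j)).const_mul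
    (1 / 2 : ℝ)).congr_fderiv ?_
  ext v
  simp only [smul_apply, sum_apply, Finset.sum_filter,
    InnerProductSpace.toDual_apply_apply, PiLp.inner_apply, RCLike.inner_apply, conj_trivial,
    smul_eq_mul, Finset.mul_sum, PiLp.smul_apply]
  refine Finset.sum_congr rfl fun j _ => ?_
  by_cases hj : lam j = lamMax lam
  · rw [if_pos hj, topProj_apply_of_eq hj, hj]
    simp
    ring
  · rw [if_neg hj, topProj_apply_of_ne hj]
    simp

/-- The exponent `ρ` with `‖u‖_Λ² = a e^{2 λ_max ρ}`. -/
def topExponent (lam : Fin m → ℝ) (a : ℝ) (u : EuclideanSpace ℝ (Fin m)) : ℝ :=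
  (Real.log (lamSeminormSq lam u) - Real.log a) * (2 * lamMax lam)⁻¹

theorem lamSeminormSq_eq_mul_exp_topExponent (hM : 0 < lamMax lam) {a : ℝ} (ha : 0 < a)
    {u : EuclideanSpace ℝ (Fin m)} (hu : 0 < lamSeminormSq lam u) :
    lamSeminormSq lam u = a * Real.exp (lamMax lam * topExponent lam a u) ^ 2 := by
  rw [← Real.exp_nat_mul, topExponent]
  have : ((2 : ℕ) : ℝ) * (lamMax lam * ((Real.log (lamSeminormSq lam u) - Real.log a)
      * (2 * lamMax lam)⁻¹)) = Real.log (lamSeminormSq lam u) - Real.log a := by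
    push_cast
    field_simp
  rw [this, Real.exp_sub, Real.exp_log hu, Real.exp_log ha, mul_div_cancel₀ _ ha.ne']

theorem tendsto_exp_sub_mul {ι : Type*} {l : Filter ι} {τ : ι → ℝ} (hτ : Tendsto τ l atTop)
    {u : ι → EuclideanSpace ℝ (Fin m)} (hu : Tendsto u l (𝓝 θlim)) (j : Fin m) :
    Tendsto (fun t => Real.exp (2 * (lam j - lamMax lam) * τ t) * u t j) l
      (𝓝 (topProj lam θlim j)) := by
  have h1 : Tendsto (fun t => u t j) l (𝓝 (θlim j)) :=
    ((EuclideanSpace.proj j : EuclideanSpace ℝ (Fin m) →L[ℝ] ℝ).continuous.tendsto θlim).comp hu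
  by_cases hj : lam j = lamMax lam
  · simpa [topProj_apply_of_eq hj, hj] using h1
  · rw [topProj_apply_of_ne hj]
    have hneg : 2 * (lam j - lamMax lam) < 0 := by
      linarith [(le_lamMax lam j).lt_of_ne hj]
    simpa using (Real.tendsto_exp_atBot.comp (hτ.const_mul_atTop_of_neg hneg)).mul h1

/-- S e^{-2λ_max τ} tends to the squared top seminorm of the limit, since coordinates of lower rate
decay relative to e^{λ_max τ}. -/
theorem tendsto_topExponent_sub_lamTau (hlam : ∀ i, 0 ≤ lam i) (hne : lam ≠ 0) {ι : Type*}
    {l : Filter ι} {u : ι → EuclideanSpace ℝ (Fin m)}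
    (hτ : Tendsto (fun t => lamTau lam (u t)) l atTop)
    (hu : Tendsto (fun t => lamNormalize lam (u t)) l (𝓝 θlim))
    (hlim : 0 < lamMaxSeminormSq lam θlim) (hpos : ∀ᶠ t in l, 0 < lamSeminormSq lam (u t)) :
    Tendsto (fun t => topExponent lam (lamMaxSeminormSq lam θlim) (u t) - lamTau lam (u t)) l
      (𝓝 0) := by
  have hM := lamMax_pos hlam hne
  have h1 : Tendsto (fun t => ∑ j, lam j * (Real.exp (2 * (lam j - lamMax lam) * lamTau lam (u t))
      * lamNormalize lam (u t) j * lamNormalize lam (u t) j)) l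
      (𝓝 (lamMaxSeminormSq lam θlim)) := by
    rw [lamMaxSeminormSq_eq_sum]
    refine tendsto_finsetSum _ fun j _ => ?_
    have h2 : Tendsto (fun t => lamNormalize lam (u t) j) l (𝓝 (θlim j)) :=
      ((EuclideanSpace.proj j : EuclideanSpace ℝ (Fin m) →L[ℝ] ℝ).continuous.tendsto θlim).comp hu
    have h3 : topProj lam θlim j ^ 2 = topProj lam θlim j * θlim j := by
      by_cases hj : lam j = lamMax lam
      · rw [topProj_apply_of_eq hj, sq]
      · rw [topProj_apply_of_ne hj]
        simp
    rw [h3]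
    exact ((tendsto_exp_sub_mul hτ hu j).mul h2).const_mul (lam j)
  have h4 := ((h1.log hlim.ne').sub_const
    (Real.log (lamMaxSeminormSq lam θlim))).mul_const (2 * lamMax lam)⁻¹
  rw [sub_self, zero_mul] at h4
  refine h4.congr' ?_
  filter_upwards [hpos] with t ht
  have h5 : ∑ j, lam j * (Real.exp (2 * (lam j - lamMax lam) * lamTau lam (u t))
      * lamNormalize lam (u t) j * lamNormalize lam (u t) j)
      = Real.exp (-(2 * lamMax lam * lamTau lam (u t))) * lamSeminormSq lam (u t) := by
    have h6 := lamSeminormSq_psi lam (lamTau lam (u t)) (lamNormalize lam (u t))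
    rw [psi_lamTau_lamNormalize] at h6
    rw [h6, Finset.mul_sum]
    refine Finset.sum_congr rfl fun j _ => ?_
    rw [show 2 * (lam j - lamMax lam) * lamTau lam (u t)
      = -(2 * lamMax lam * lamTau lam (u t)) + 2 * lam j * lamTau lam (u t) by ring, Real.exp_add]
    ring
  rw [h5, Real.log_mul (Real.exp_pos _).ne' ht.ne', Real.log_exp, topExponent]
  field_simp
  ring

/-- If Φ - βX were nonincreasing from T on, it would stay bounded above; dividing by X → ∞ gives lim
Φ/X ≤ β. -/
theorem not_ae_hasDerivAt_nonpos_of_tendsto_div {Φ X : ℝ → ℝ} {β c T : ℝ} (hT : 0 ≤ T)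
    (hac : ∀ a b, T ≤ a → a ≤ b → AbsolutelyContinuousOnInterval (fun t => Φ t - β * X t) a b)
    (hlim : Tendsto (fun t => Φ t / X t) atTop (𝓝 c)) (hX : Tendsto X atTop atTop) (hβ : β < c) :
    ¬ ∀ᵐ t ∂(volume.restrict (Ioi (0 : ℝ))), T < t →
      ∃ F' ≤ 0, HasDerivAt (fun t => Φ t - β * X t) F' t := by
  intro hae
  have hanti := antitoneOn_of_ae_hasDerivAt_nonpos hT hac hae
  have h1 : Tendsto (fun t => β + (Φ T - β * X T) / X t) atTop (𝓝 (β + 0)) :=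
    (hX.const_div_atTop _).const_add β
  refine absurd (le_of_tendsto_of_tendsto hlim h1 ?_) (not_le.2 (by simpa using hβ))
  filter_upwards [eventually_ge_atTop T, hX.eventually_gt_atTop 0] with t ht hpos
  have h2 : Φ t - β * X t ≤ Φ T - β * X T := hanti self_mem_Ici ht ht
  rw [div_le_iff₀ hpos, add_mul, div_mul_cancel₀ _ hpos.ne']
  linarith

end DirectionalConvergence

/-! ### Rescaled coordinates and the active hull -/

section KKT

variable {d m n : ℕ} {f : EuclideanSpace ℝ (Fin d) → EuclideanSpace ℝ (Fin m) → ℝ}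
  {x : Fin n → EuclideanSpace ℝ (Fin d)} {y : Fin n → ℝ} {lam : Fin m → ℝ}
  {θ : ℝ → EuclideanSpace ℝ (Fin m)} {t t₀ : ℝ} {θlim : EuclideanSpace ℝ (Fin m)}

/-- The rescaled coordinate `e^{(λ_j - λ_max) ρ} u_j`. -/
def scaledCoord (lam : Fin m → ℝ) (a : ℝ) (u : EuclideanSpace ℝ (Fin m)) (j : Fin m) : ℝ :=
  Real.exp ((lam j - lamMax lam) * topExponent lam a u) * u j

/-- Since θ_j = e^{λ_j τ} θ̂_j and ρ - τ → 0, the quotient behaves like e^{2(λ_j - λ_max)ρ} θ̂_j,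
which keeps only the top-rate coordinates. -/
theorem tendsto_scaledCoord_div {ι : Type*} {l : Filter ι} {a : ℝ}
    {u : ι → EuclideanSpace ℝ (Fin m)}
    (hρ : Tendsto (fun t => topExponent lam a (u t)) l atTop)
    (hρτ : Tendsto (fun t => topExponent lam a (u t) - lamTau lam (u t)) l (𝓝 0))
    (hu : Tendsto (fun t => lamNormalize lam (u t)) l (𝓝 θlim)) (j : Fin m) :
    Tendsto (fun t => scaledCoord lam a (u t) j /
      Real.exp (lamMax lam * topExponent lam a (u t))) l (𝓝 (topProj lam θlim j)) := by
  have h1 := (Real.continuous_exp.tendsto _).comp (hρτ.const_mul (-lam j))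
  have h2 := h1.mul (tendsto_exp_sub_mul (lam := lam) hρ hu j)
  rw [mul_zero, Real.exp_zero, one_mul] at h2
  refine h2.congr fun t => ?_
  have h3 : u t j = Real.exp (lamTau lam (u t) * lam j) * lamNormalize lam (u t) j := by
    conv_lhs => rw [← psi_lamTau_lamNormalize lam (u t)]
    rfl
  rw [scaledCoord, div_eq_mul_inv, ← Real.exp_neg, h3, Function.comp_apply]
  have h4 : Real.exp (-lam j * (topExponent lam a (u t) - lamTau lam (u t)))
      * Real.exp (2 * (lam j - lamMax lam) * topExponent lam a (u t))
      = Real.exp ((lam j - lamMax lam) * topExponent lam a (u t))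
        * Real.exp (lamTau lam (u t) * lam j)
        * Real.exp (-(lamMax lam * topExponent lam a (u t))) := by
    simp only [← Real.exp_add]
    congr 1
    ring
  linear_combination lamNormalize lam (u t) j * h4

theorem hasDerivAt_scaledCoord_comp {a R : ℝ} {z' : EuclideanSpace ℝ (Fin m)}
    (hz : HasDerivAt θ z' t) (hR : HasDerivAt (fun s => topExponent lam a (θ s)) R t) (j : Fin m) :
    HasDerivAt (fun s => scaledCoord lam a (θ s) j)
      ((lam j - lamMax lam) * R * scaledCoord lam a (θ t) j
        + Real.exp ((lam j - lamMax lam) * topExponent lam a (θ t)) * z' j) t := by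
  refine (((hR.const_mul (lam j - lamMax lam)).exp).fun_mul (hz.euclidean_apply j)).congr_deriv ?_
  rw [scaledCoord]
  ring

theorem contDiffAt_topExponent {a : ℝ} {u : EuclideanSpace ℝ (Fin m)}
    (hu : 0 < lamSeminormSq lam u) : ContDiffAt ℝ 1 (topExponent lam a) u :=
  (((contDiff_lamSeminormSq lam).contDiffAt.log hu.ne').sub contDiffAt_const).mul contDiffAt_const

theorem contDiffAt_scaledCoord {a : ℝ} {u : EuclideanSpace ℝ (Fin m)}
    (hu : 0 < lamSeminormSq lam u) (j : Fin m) :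
    ContDiffAt ℝ 1 (fun u => scaledCoord lam a u j) u := by
  have h1 : ContDiffAt ℝ 1 (fun u : EuclideanSpace ℝ (Fin m) => u j) u := by fun_prop
  exact ((contDiffAt_const.mul (contDiffAt_topExponent hu)).exp).mul h1

/-- The last sum is Φ'/X', with Φ and X as in the converse L'Hôpital argument. It exceeds β at
arbitrarily late times because lim Φ/X does. -/
theorem exists_lt_sum_of_lt_inner (hn : 0 < n) (hlam : ∀ i, 0 ≤ lam i) (hne : lam ≠ 0)
    (hquasi : ∀ a, IsQuasiHomogeneous lam (f a)) (hlip : ∀ a, LocallyLipschitz (f a))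
    (hchain : ∀ a, AdmitsChainRule (f a)) (hflow : IsGradientFlow (expLoss f x y) θ)
    (ht₀ : 0 ≤ t₀) (hS : ∀ t, t₀ ≤ t → 0 < lamSeminormSq lam (θ t))
    (hrate : ∀ t, t₀ ≤ t → 0 < lossRate f x y (θ t)) {a : ℝ} (ha : 0 < a)
    (hρ : Tendsto (fun t => topExponent lam a (θ t)) atTop atTop)
    (hρτ : Tendsto (fun t => topExponent lam a (θ t) - lamTau lam (θ t)) atTop (𝓝 0))
    (hconv : Tendsto (fun t => lamNormalize lam (θ t)) atTop (𝓝 θlim))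
    {v : EuclideanSpace ℝ (Fin m)} {β : ℝ} (hβ : β < ∑ j, v j * topProj lam θlim j) (T : ℝ) :
    ∃ t, T ≤ t ∧ t₀ ≤ t ∧ ∃ k : Fin n → EuclideanSpace ℝ (Fin m),
      (∀ i, k i ∈ clarkeSubdiff (f (x i)) (lamNormalize lam (θ t))) ∧
      β < ∑ j, v j * ((lam j - lamMax lam) / lamMax lam *
          (scaledCoord lam a (θ t) j / Real.exp (lamMax lam * topExponent lam a (θ t)))
        + a * Real.exp (lam j * (topExponent lam a (θ t) - lamTau lam (θ t))) *
          (∑ i, (lossWeight f x y (θ t) i * y i) • k i) j /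
          ∑ i, lossWeight f x y (θ t) i * (y i * f (x i) (lamNormalize lam (θ t)))) := by
  have hM := lamMax_pos hlam hne
  by_contra! hcon
  refine not_ae_hasDerivAt_nonpos_of_tendsto_div
    (Φ := fun t => ∑ j, v j * scaledCoord lam a (θ t) j)
    (X := fun t => Real.exp (lamMax lam * topExponent lam a (θ t))) (T := max T t₀)
    (ht₀.trans (le_max_right _ _)) (fun b b' hb hbb' => ?_) ?_
    (Real.tendsto_exp_atTop.comp (hρ.const_mul_atTop hM)) hβ ?_
  · refine (hflow.1.absolutelyContinuousOnInterval (ht₀.trans ((le_max_right _ _).trans hb))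
      hbb').comp_contDiffAt (G := fun u => ∑ j, v j * scaledCoord lam a u j
        - β * Real.exp (lamMax lam * topExponent lam a u)) fun t ht => ?_
    rw [uIcc_of_le hbb'] at ht
    have hSt := hS t ((le_max_right _ _).trans (hb.trans ht.1))
    exact (ContDiffAt.sum fun j _ => contDiffAt_const.mul (contDiffAt_scaledCoord hSt j)).sub
      (contDiffAt_const.mul ((contDiffAt_const.mul (contDiffAt_topExponent hSt)).exp))
  · simp only [Finset.sum_div, mul_div_assoc]
    exact tendsto_finsetSum _ fun j _ =>
      (tendsto_scaledCoord_div hρ hρτ hconv j).const_mul (v j)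
  · filter_upwards [hflow.ae_exists_isFlowVelocity hlip hchain] with t ⟨h, hv⟩ ht
    have htt₀ := (le_max_right _ _).trans ht.le
    have hSt := hS t htt₀
    obtain ⟨k, hk, hk'⟩ := hv.exists_deriv_apply_eq hn hquasi
    have hle := hcon t ((le_max_left _ _).trans ht.le) htt₀ k hk
    have hR : HasDerivAt (fun s => topExponent lam a (θ s))
        (2 * lossRate f x y (θ t) / lamSeminormSq lam (θ t) * (2 * lamMax lam)⁻¹) t :=
      (((hv.hasDerivAt_lamSeminormSq hquasi hlip).log hSt.ne').sub_const _).mul_const _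
    have hP := lossRate_eq (x := x) (y := y) hn hquasi (θ t)
    have hPpos := hrate t htt₀
    have hSeq := lamSeminormSq_eq_mul_exp_topExponent hM ha hSt
    have hL := expLoss_pos (f := f) (x := x) (y := y) hn (θ t)
    have hd := (HasDerivAt.fun_sum fun j (_ : j ∈ Finset.univ) =>
      (hasDerivAt_scaledCoord_comp hv.differentiableAt.hasDerivAt hR j).const_mul (v j)).fun_sub
      (((hR.const_mul (lamMax lam)).exp).const_mul β)
    refine ⟨_, ?_, hd⟩
    set R := 2 * lossRate f x y (θ t) / lamSeminormSq lam (θ t) * (2 * lamMax lam)⁻¹ with hRdef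
    set X := Real.exp (lamMax lam * topExponent lam a (θ t)) with hX
    set g := ∑ i, lossWeight f x y (θ t) i * (y i * f (x i) (lamNormalize lam (θ t)))
    set L := expLoss f x y (θ t)
    have hXpos : 0 < X := Real.exp_pos _
    have hLτ : 0 < L * Real.exp (lamTau lam (θ t)) := mul_pos hL (Real.exp_pos _)
    have hg : 0 < g := by
      rw [hP] at hPpos
      exact pos_of_mul_pos_right hPpos hLτ.le
    have hReq : lamMax lam * R = L * Real.exp (lamTau lam (θ t)) * g / (a * X ^ 2) := by
      rw [hRdef, hSeq, hP]
      field_simp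
    have hRpos : 0 < lamMax lam * R := by
      rw [hReq]
      positivity
    -- X λ_max R is X'. The rescaling e^{(λ_j - λ_max)ρ} cancels e^{-λ_j τ} in the velocity up to
    -- e^{λ_j(ρ - τ)}, which tends to 1, leaving a factor common to all coordinates.
    have hterm : ∀ j, (lam j - lamMax lam) * R * scaledCoord lam a (θ t) j
        + Real.exp ((lam j - lamMax lam) * topExponent lam a (θ t)) * deriv θ t j
        = X * (lamMax lam * R) * ((lam j - lamMax lam) / lamMax lam *
          (scaledCoord lam a (θ t) j / X)
        + a * Real.exp (lam j * (topExponent lam a (θ t) - lamTau lam (θ t))) *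
          (∑ i, (lossWeight f x y (θ t) i * y i) • k i) j / g) := by
      intro j
      rw [mul_add]
      congr 1
      · field_simp
      · have h1 : Real.exp ((lam j - lamMax lam) * topExponent lam a (θ t))
            * Real.exp (-(lam j * lamTau lam (θ t)))
            = Real.exp (lam j * (topExponent lam a (θ t) - lamTau lam (θ t))) / X := by
          rw [hX, ← Real.exp_add, ← Real.exp_sub]
          congr 1
          ring
        rw [hk', hReq]
        calc _ = L * Real.exp (lamTau lam (θ t)) * (Real.exp ((lam j - lamMax lam)
                  * topExponent lam a (θ t)) * Real.exp (-(lam j * lamTau lam (θ t))))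
                * (∑ i, (lossWeight f x y (θ t) i * y i) • k i) j := by ring
          _ = _ := by
            rw [h1]
            field_simp
    simp only [hterm]
    have hfac : ∀ c : Fin m → ℝ, ∑ j, v j * (X * (lamMax lam * R) * c j)
        - β * (X * (lamMax lam * R)) = X * (lamMax lam * R) * (∑ j, v j * c j - β) := by
      intro c
      rw [mul_sub, Finset.mul_sum]
      congr 1
      · exact Finset.sum_congr rfl fun j _ => by ring
      · ring
    rw [hfac]
    exact mul_nonpos_of_nonneg_of_nonpos (by positivity) (sub_nonpos.2 hle)

/-- The convex combinations of signed subgradients supported on the active constraints. -/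
def activeHull {ι : Type*} [Fintype ι] (D : ι → Set (EuclideanSpace ℝ (Fin m))) (Q y : ι → ℝ)
    (γ : ℝ) : Set (EuclideanSpace ℝ (Fin m)) :=
  {p | ∃ (w : ι → ℝ) (h : ι → EuclideanSpace ℝ (Fin m)), w ∈ stdSimplex ℝ ι ∧
    (∀ i, w i * (Q i - γ) = 0) ∧ (∀ i, h i ∈ D i) ∧ p = ∑ i, (w i * y i) • h i}

/-- Mixing two combinations mixes their weights; each subgradient becomes a weighted average, which
stays in the convex set `D i`. Where the mixed weight vanishes, any subgradient will do. -/
theorem convex_activeHull {ι : Type*} [Fintype ι] {D : ι → Set (EuclideanSpace ℝ (Fin m))}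
    (hD : ∀ i, Convex ℝ (D i)) (Q y : ι → ℝ) (γ : ℝ) : Convex ℝ (activeHull D Q y γ) := by
  rintro _ ⟨w, h, hw, hwQ, hh, rfl⟩ _ ⟨w', h', hw', hwQ', hh', rfl⟩ a b ha hb hab
  have key : ∀ i, ∃ k ∈ D i, (a * w i + b * w' i) • k = (a * w i) • h i + (b * w' i) • h' i := by
    intro i
    have h1 : 0 ≤ a * w i := mul_nonneg ha (hw.1 i)
    have h2 : 0 ≤ b * w' i := mul_nonneg hb (hw'.1 i)
    rcases (add_nonneg h1 h2).eq_or_lt with h0 | hpos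
    · refine ⟨h i, hh i, ?_⟩
      rw [show a * w i = 0 by linarith, show b * w' i = 0 by linarith]
      simp
    · refine ⟨(a * w i / (a * w i + b * w' i)) • h i + (b * w' i / (a * w i + b * w' i)) • h' i,
        hD i (hh i) (hh' i) (by positivity) (by positivity) ?_, ?_⟩
      · rw [← add_div, div_self hpos.ne']
      · rw [smul_add, smul_smul, smul_smul, mul_div_cancel₀ _ hpos.ne', mul_div_cancel₀ _ hpos.ne']
  choose k hk hk' using key
  refine ⟨fun i => a * w i + b * w' i, k, convex_stdSimplex ℝ ι hw hw' ha hb hab, fun i => ?_, hk,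
    ?_⟩
  · linear_combination a * hwQ i + b * hwQ' i
  · rw [Finset.smul_sum, Finset.smul_sum, ← Finset.sum_add_distrib]
    refine Finset.sum_congr rfl fun i _ => ?_
    have hki : ((a * w i + b * w' i) * y i) • k i
        = y i • ((a * w i) • h i + (b * w' i) • h' i) := by
      rw [← hk', smul_smul, mul_comm]
    rw [hki, smul_add]
    simp only [smul_smul]
    congr 2 <;> ring

theorem isClosed_activeHull {ι : Type*} [Fintype ι] {g : ι → EuclideanSpace ℝ (Fin m) → ℝ}
    (hg : ∀ i, LocallyLipschitz (g i)) (u : EuclideanSpace ℝ (Fin m)) (Q y : ι → ℝ) (γ : ℝ) :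
    IsClosed (activeHull (fun i => clarkeSubdiff (g i) u) Q y γ) := by
  refine IsSeqClosed.isClosed fun ps p hps hp => ?_
  choose w h hw hwQ hh hsum using hps
  obtain ⟨h₀, φ, hφ, hh₀, hlim⟩ := exists_subseq_tendsto_clarkeSubdiff hg hh
    (tendsto_const_nhds (x := u))
  obtain ⟨w₀, hw₀, ψ, hψ, hwlim⟩ := (isCompact_stdSimplex ℝ ι).tendsto_subseq fun k => hw (φ k)
  have hwi := tendsto_pi_nhds.1 hwlim
  have hhi := tendsto_pi_nhds.1 (hlim.comp hψ.tendsto_atTop)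
  refine ⟨w₀, h₀, hw₀, fun i => ?_, hh₀, ?_⟩
  · refine tendsto_nhds_unique ((hwi i).mul_const (Q i - γ)) ?_
    simp [hwQ]
  · refine tendsto_nhds_unique (hp.comp (hφ.tendsto_atTop.comp hψ.tendsto_atTop)) ?_
    simp only [Function.comp_def, hsum]
    exact tendsto_finsetSum _ fun i _ => ((hwi i).mul_const (y i)).smul (hhi i)

end KKT

/-! ### Stationarity of the limit and the KKT multipliers -/

section Assembly

variable {d m n : ℕ} {f : EuclideanSpace ℝ (Fin d) → EuclideanSpace ℝ (Fin m) → ℝ}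
  {x : Fin n → EuclideanSpace ℝ (Fin d)} {y : Fin n → ℝ} {lam : Fin m → ℝ}
  {θ : ℝ → EuclideanSpace ℝ (Fin m)} {t₀ : ℝ} {θlim : EuclideanSpace ℝ (Fin m)}

/-- The softmin weights of inactive constraints vanish in the limit. -/
theorem tendsto_lossWeight_zero (hquasi : ∀ a, IsQuasiHomogeneous lam (f a))
    {us : ℕ → EuclideanSpace ℝ (Fin m)} {Q : Fin n → ℝ} {i i₀ : Fin n}
    (hτ : Tendsto (fun k => lamTau lam (us k)) atTop atTop)
    (hQ : ∀ i, Tendsto (fun k => y i * f (x i) (lamNormalize lam (us k))) atTop (𝓝 (Q i)))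
    (hn : 0 < n) (hlt : Q i₀ < Q i) :
    Tendsto (fun k => lossWeight f x y (us k) i) atTop (𝓝 0) := by
  have h1 : Tendsto (fun k => Real.exp (lamTau lam (us k)) *
      (y i₀ * f (x i₀) (lamNormalize lam (us k)) - y i * f (x i) (lamNormalize lam (us k))))
      atTop atBot :=
    (Real.tendsto_exp_atTop.comp hτ).atTop_mul_neg (sub_neg.2 hlt) ((hQ i₀).sub (hQ i))
  refine squeeze_zero (fun k => (lossWeight_mem_stdSimplex hn (us k)).1 i) (fun k => ?_)
    (Real.tendsto_exp_atBot.comp h1)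
  refine (lossWeight_le (us k) i i₀).trans (le_of_eq ?_)
  rw [apply_eq_exp_lamTau_mul hquasi (x i) (us k), apply_eq_exp_lamTau_mul hquasi (x i₀) (us k),
    Function.comp_apply]
  congr 1
  ring

/-- Otherwise some v separates the point from the hull. The late times supplied for this v have a
subsequence along which weights and subgradients converge to data of an element of the hull that
violates the separation. -/
theorem smul_topProj_mem_activeHull (hn : 0 < n) (hlam : ∀ i, 0 ≤ lam i) (hne : lam ≠ 0)
    (hquasi : ∀ a, IsQuasiHomogeneous lam (f a)) (hlip : ∀ a, LocallyLipschitz (f a))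
    (hchain : ∀ a, AdmitsChainRule (f a)) (hflow : IsGradientFlow (expLoss f x y) θ)
    (ht₀ : 0 ≤ t₀) (hS : ∀ t, t₀ ≤ t → 0 < lamSeminormSq lam (θ t))
    (hrate : ∀ t, t₀ ≤ t → 0 < lossRate f x y (θ t))
    (ha : 0 < lamMaxSeminormSq lam θlim)
    (hτ : Tendsto (fun t => lamTau lam (θ t)) atTop atTop)
    (hconv : Tendsto (fun t => lamNormalize lam (θ t)) atTop (𝓝 θlim))
    {i₀ : Fin n} (hmin : ∀ i, y i₀ * f (x i₀) θlim ≤ y i * f (x i) θlim)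
    (hpos : 0 < y i₀ * f (x i₀) θlim) :
    (y i₀ * f (x i₀) θlim / lamMaxSeminormSq lam θlim) • topProj lam θlim ∈
      activeHull (fun i => clarkeSubdiff (f (x i)) θlim) (fun i => y i * f (x i) θlim) y
        (y i₀ * f (x i₀) θlim) := by
  set a := lamMaxSeminormSq lam θlim with hadef
  set γ := y i₀ * f (x i₀) θlim with hγ
  have hρτ := tendsto_topExponent_sub_lamTau hlam hne hτ hconv ha
    ((eventually_ge_atTop t₀).mono hS)
  have hρ : Tendsto (fun t => topExponent lam a (θ t)) atTop atTop := by
    refine (hτ.atTop_add hρτ).congr fun t => ?_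
    rw [add_sub_cancel]
  by_contra hnot
  obtain ⟨v, r, hr, hr'⟩ := exists_inner_lt_of_notMem
    (convex_activeHull (fun i => convex_clarkeSubdiff (f (x i)) θlim) _ y γ)
    (isClosed_activeHull (fun i => hlip (x i)) θlim _ y γ) hnot
  -- The limiting derivative quotient carries the factor a / γ, so the separating constant is
  -- rescaled by it.
  have hβ : r * (a / γ) < ∑ j, v j * topProj lam θlim j := by
    have h1 : inner ℝ v ((γ / a) • topProj lam θlim)
        = γ / a * ∑ j, v j * topProj lam θlim j := by
      rw [real_inner_smul_right, PiLp.inner_apply]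
      simp [mul_comm]
    rw [h1] at hr'
    have h2 := mul_lt_mul_of_pos_right hr' (div_pos ha hpos)
    refine h2.trans_eq ?_
    field_simp
  choose ts hts hts₀ k hk hlt using fun N : ℕ => exists_lt_sum_of_lt_inner hn hlam hne hquasi hlip
    hchain hflow ht₀ hS hrate ha hρ hρτ hconv hβ (N : ℝ)
  have hts : Tendsto ts atTop atTop := tendsto_atTop_mono hts tendsto_natCast_atTop_atTop
  obtain ⟨h, φ, hφ, hh, hhlim⟩ := exists_subseq_tendsto_clarkeSubdiff (fun i => hlip (x i)) hk
    (hconv.comp hts)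
  obtain ⟨w, hw, ψ, hψ, hwlim⟩ := (isCompact_stdSimplex ℝ (Fin n)).tendsto_subseq fun N =>
    lossWeight_mem_stdSimplex (f := f) (x := x) (y := y) hn (θ (ts (φ N)))
  have hs : Tendsto (fun N => ts (φ (ψ N))) atTop atTop :=
    hts.comp (hφ.tendsto_atTop.comp hψ.tendsto_atTop)
  have hwi : ∀ i, Tendsto (fun N => lossWeight f x y (θ (ts (φ (ψ N)))) i) atTop (𝓝 (w i)) :=
    tendsto_pi_nhds.1 hwlim
  have hki : ∀ i, Tendsto (fun N => k (φ (ψ N)) i) atTop (𝓝 (h i)) :=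
    tendsto_pi_nhds.1 (hhlim.comp hψ.tendsto_atTop)
  have hQ : ∀ i, Tendsto (fun N => y i * f (x i) (lamNormalize lam (θ (ts (φ (ψ N)))))) atTop
      (𝓝 (y i * f (x i) θlim)) := fun i =>
    (((hlip (x i)).continuous.tendsto θlim).comp (hconv.comp hs)).const_mul _
  have hwQ : ∀ i, w i * (y i * f (x i) θlim - γ) = 0 := by
    intro i
    rcases (hmin i).eq_or_lt with heq | hlt'
    · rw [hγ, ← heq, sub_self, mul_zero]
    · rw [tendsto_nhds_unique (hwi i)
        (tendsto_lossWeight_zero hquasi (hτ.comp hs) hQ hn hlt'), zero_mul]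
  have hsum : ∑ i, w i * (y i * f (x i) θlim) = γ := by
    have h1 : ∀ i, w i * (y i * f (x i) θlim) = w i * γ := fun i => by
      linear_combination hwQ i
    simp only [h1, ← Finset.sum_mul]
    rw [hw.2, one_mul]
  have hG : Tendsto (fun N => ∑ i, (lossWeight f x y (θ (ts (φ (ψ N)))) i * y i) • k (φ (ψ N)) i)
      atTop (𝓝 (∑ i, (w i * y i) • h i)) :=
    tendsto_finsetSum _ fun i _ => ((hwi i).mul_const (y i)).smul (hki i)
  have hg : Tendsto (fun N => ∑ i, lossWeight f x y (θ (ts (φ (ψ N)))) i *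
      (y i * f (x i) (lamNormalize lam (θ (ts (φ (ψ N))))))) atTop (𝓝 γ) := by
    rw [← hsum]
    exact tendsto_finsetSum _ fun i _ => (hwi i).mul (hQ i)
  have hlimj : ∀ j, Tendsto (fun N => v j * ((lam j - lamMax lam) / lamMax lam *
          (scaledCoord lam a (θ (ts (φ (ψ N)))) j /
            Real.exp (lamMax lam * topExponent lam a (θ (ts (φ (ψ N))))))
        + a * Real.exp (lam j * (topExponent lam a (θ (ts (φ (ψ N))))
            - lamTau lam (θ (ts (φ (ψ N)))))) *
          (∑ i, (lossWeight f x y (θ (ts (φ (ψ N)))) i * y i) • k (φ (ψ N)) i) j /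
          ∑ i, lossWeight f x y (θ (ts (φ (ψ N)))) i *
            (y i * f (x i) (lamNormalize lam (θ (ts (φ (ψ N)))))))) atTop
      (𝓝 (v j * (a * (∑ i, (w i * y i) • h i) j / γ))) := by
    intro j
    have h1 := ((tendsto_scaledCoord_div hρ hρτ hconv j).comp hs).const_mul
      ((lam j - lamMax lam) / lamMax lam)
    -- The drift from differentiating the rescaling disappears: for top-rate coordinates the
    -- prefactor is zero, for the others the limit is.
    have h2 : (lam j - lamMax lam) / lamMax lam * topProj lam θlim j = 0 := by
      by_cases hj : lam j = lamMax lam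
      · rw [hj, sub_self, zero_div, zero_mul]
      · rw [topProj_apply_of_ne hj, mul_zero]
    rw [h2] at h1
    have h3 := (((Real.continuous_exp.tendsto _).comp ((hρτ.comp hs).const_mul (lam j))).const_mul
      a).mul (((EuclideanSpace.proj j : EuclideanSpace ℝ (Fin m) →L[ℝ] ℝ).continuous.tendsto
        _).comp hG)
    have h4 := (h1.add (h3.div hg hpos.ne')).const_mul (v j)
    rw [mul_zero, Real.exp_zero, mul_one, zero_add] at h4
    exact h4
  have hfin := ge_of_tendsto (tendsto_finsetSum Finset.univ fun j _ => hlimj j)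
    (Eventually.of_forall fun N => (hlt (φ (ψ N))).le)
  have hlast := hr _ ⟨w, h, hw, hwQ, hh, rfl⟩
  rw [PiLp.inner_apply] at hlast
  have h5 : ∑ j, v j * (a * (∑ i, (w i * y i) • h i) j / γ)
      = (∑ j, inner ℝ (v j) ((∑ i, (w i * y i) • h i) j)) * (a / γ) := by
    rw [Finset.sum_mul]
    refine Finset.sum_congr rfl fun j _ => ?_
    rw [RCLike.inner_apply, conj_trivial]
    ring
  rw [h5] at hfin
  exact absurd (le_of_mul_le_mul_right hfin (div_pos ha hpos)) (not_le.2 hlast)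

/-- A multiple of the top-rate part in the active hull yields a first-order KKT point. -/
theorem isFirstOrderKKT_psi (hlam : ∀ i, 0 ≤ lam i)
    (hquasi : ∀ a, IsQuasiHomogeneous lam (f a)) (ha : 0 < lamMaxSeminormSq lam θlim) {γ : ℝ}
    (hγ : 0 < γ) (hmin : ∀ i, γ ≤ y i * f (x i) θlim)
    (hmem : (γ / lamMaxSeminormSq lam θlim) • topProj lam θlim ∈
      activeHull (fun i => clarkeSubdiff (f (x i)) θlim) (fun i => y i * f (x i) θlim) y γ) :
    IsFirstOrderKKT lam f x y (psi lam (-Real.log γ) θlim) := by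
  obtain ⟨w, h, hw, hwQ, hh, hsum⟩ := hmem
  -- This α multiplies all margins by 1/γ, so the least one becomes exactly 1.
  set α := -Real.log γ with hα
  set a := lamMaxSeminormSq lam θlim
  have hexp : Real.exp α = γ⁻¹ := by rw [hα, Real.exp_neg, Real.exp_log hγ]
  have hmargin : ∀ i, y i * f (x i) (psi lam α θlim) = γ⁻¹ * (y i * f (x i) θlim) := by
    intro i
    rw [hquasi (x i), hexp]
    ring
  have hMnn : 0 ≤ lamMax lam := Real.iSup_nonneg hlam
  -- The multipliers are forced by the top coordinates: ψ_{-α} contributes e^{-αλ_max}, while the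
  -- gradient at the rescaled point contains e^{αλ_max}. The factor a and e^α = 1/γ cancel γ / a.
  refine ⟨fun i => ?_, fun i => lamMax lam * a * Real.exp (α * lamMax lam) ^ 2 * w i,
    fun i => Real.exp α • psi lam (-α) (h i), fun i => ?_, fun i => ?_, ?_, fun i => ?_⟩
  · rw [hmargin, inv_mul_eq_div, one_le_div hγ]
    exact hmin i
  · exact mul_nonneg (by positivity) (hw.1 i)
  · exact (hquasi (x i)).smul_psi_mem_clarkeSubdiff α (hh i)
  · rw [gradient_half_lamMaxSeminormSq]
    have h1 : ∑ i, (lamMax lam * a * Real.exp (α * lamMax lam) ^ 2 * w i * y i) •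
        Real.exp α • psi lam (-α) (h i)
        = (lamMax lam * a * Real.exp (α * lamMax lam) ^ 2 * Real.exp α) •
          psiCLM lam (-α) (∑ i, (w i * y i) • h i) := by
      rw [map_sum, Finset.smul_sum]
      refine Finset.sum_congr rfl fun i _ => ?_
      rw [map_smul, psiCLM_apply, smul_smul, smul_smul]
      congr 1
      ring
    rw [h1, ← hsum, map_smul, psiCLM_apply, smul_smul, hexp]
    ext j
    simp only [PiLp.smul_apply, smul_eq_mul, psi_apply]
    by_cases hj : lam j = lamMax lam
    · rw [topProj_apply_of_eq hj, topProj_apply_of_eq hj, psi_apply, hj]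
      have h2 : Real.exp (-α * lamMax lam) = (Real.exp (α * lamMax lam))⁻¹ := by
        rw [← Real.exp_neg, neg_mul]
      rw [h2]
      have := (Real.exp_pos (α * lamMax lam)).ne'
      field_simp
    · rw [topProj_apply_of_ne hj, topProj_apply_of_ne hj]
      simp
  · rw [hmargin]
    have h2 : w i * (γ⁻¹ * (y i * f (x i) θlim) - 1) = 0 := by
      have h3 : γ⁻¹ * (y i * f (x i) θlim) - 1 = γ⁻¹ * (y i * f (x i) θlim - γ) := by
        field_simp
      rw [h3, mul_left_comm, hwQ i, mul_zero]
    rw [mul_assoc, h2, mul_zero]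

end Assembly

end

theorem theorem1 {d m n : ℕ} (hn : 0 < n)
    (f : EuclideanSpace ℝ (Fin d) → EuclideanSpace ℝ (Fin m) → ℝ)
    (x : Fin n → EuclideanSpace ℝ (Fin d)) (y : Fin n → ℝ) (hy : ∀ i, y i = 1 ∨ y i = -1)
    (lam : Fin m → ℝ) (hlam_nonneg : ∀ i, 0 ≤ lam i) (hlam_ne : lam ≠ 0)
    (hquasi : ∀ a : EuclideanSpace ℝ (Fin d), IsQuasiHomogeneous lam (f a))
    (hlip : ∀ a : EuclideanSpace ℝ (Fin d), LocallyLipschitz (f a))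
    (hchain : ∀ a : EuclideanSpace ℝ (Fin d), AdmitsChainRule (f a))
    (θ : ℝ → EuclideanSpace ℝ (Fin m)) (hflow : IsGradientFlow (expLoss f x y) θ)
    (hsep : ∃ t₀ : ℝ, 0 ≤ t₀ ∧ expLoss f x y (θ t₀) < (n : ℝ)⁻¹)
    (θlim : EuclideanSpace ℝ (Fin m))
    (hconv : Tendsto (fun t => lamNormalize lam (θ t)) atTop (𝓝 θlim))
    (hcond : ConditionallySeparable lam f x y) :
    ∃ α : ℝ, IsFirstOrderKKT lam f x y (psi lam α θlim) := by
  obtain ⟨t₀, ht₀, hLt₀⟩ := hsep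
  obtain ⟨κ, hκ, hκθ⟩ := hcond
  have hL : ∀ t, t₀ ≤ t → expLoss f x y (θ t) ≤ expLoss f x y (θ t₀) := fun t ht =>
    antitoneOn_expLoss hflow hlip hchain ht₀ (ht₀.trans ht) ht
  have hℓ : ∀ t, t₀ ≤ t → 0 < smoothMargin f x y (θ t) := fun t ht =>
    smoothMargin_pos hn ((hL t ht).trans_lt hLt₀)
  -- The square appears because `lamMaxSeminormSq` is the squared seminorm, while κ bounds the
  -- seminorm itself.
  have hκsq : ∀ t, t₀ ≤ t → κ ^ 2 ≤ lamMaxSeminormSq lam (lamNormalize lam (θ t)) := fun t ht =>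
    (Real.le_sqrt' hκ).1 (hκθ (θ t) fun i => (hℓ t ht).trans_le (smoothMargin_le hn (θ t) i))
  have hκ2 : 0 < κ ^ 2 := by positivity
  have hS : ∀ t, t₀ ≤ t → 0 < lamSeminormSq lam (θ t) := fun t ht =>
    lamSeminormSq_pos_of_lamMaxSeminormSq_lamNormalize_pos hlam_nonneg
      (hκ2.trans_le (hκsq t ht))
  have ha : 0 < lamMaxSeminormSq lam θlim :=
    hκ2.trans_le (ge_of_tendsto
      (((contDiff_lamMaxSeminormSq lam).continuous.tendsto θlim).comp hconv)
      ((eventually_ge_atTop t₀).mono hκsq))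
  obtain ⟨c, hc, hmargin⟩ := exists_pos_le_margin_lamNormalize hn hlam_nonneg hlam_ne hquasi hlip
    hchain hflow ht₀ hℓ hκ2 hκsq
  have hQ : ∀ i, 0 < y i * f (x i) θlim := fun i =>
    hc.trans_le (ge_of_tendsto
      ((((hlip (x i)).continuous.tendsto θlim).comp hconv).const_mul (y i))
      ((eventually_ge_atTop t₀).mono fun t ht => hmargin t ht i))
  have hτ := tendsto_lamTau_atTop hlam_nonneg (tendsto_lamSeminormSq_atTop hn hlam_nonneg hlam_ne
    hquasi hlip hchain hflow ht₀ hL hℓ hκ2 hκsq hconv)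
  have : Nonempty (Fin n) := ⟨⟨0, hn⟩⟩
  obtain ⟨i₀, hmin⟩ := Finite.exists_min fun i => y i * f (x i) θlim
  exact ⟨_, isFirstOrderKKT_psi hlam_nonneg hquasi ha (hQ i₀) hmin
    (smul_topProj_mem_activeHull hn hlam_nonneg hlam_ne hquasi hlip hchain hflow ht₀ hS
      (fun t ht => lossRate_pos hn (hℓ t ht)) ha hτ hconv hmin (hQ i₀))⟩
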